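/- Let $N_n,B_n,K_n$ ($n\in\mathbb N$) be dimensions with $N_n\ge 1$, $N_n\to\infty$, $B_n/N_n\to\bar B$ and $K_n/N_n\to\bar K$ (in particular the ratios may be constant). For each $n$ let $\mathbf S_n$ be a random complex $N_n\times K_n$ matrix with spectral decomposition $\mathbf S_n\mathbf S_n^\dagger=\sum_{i=1}^{N_n}\lambda_i\mathbf u_i\mathbf u_i^\dagger$, where $\lambda_1\ge\lambda_2\ge\dots\ge\lambda_{N_n}$ and $(\mathbf u_i)$ is a (measurably chosen) orthonormal system; $\lambda_i,\mathbf u_i$ depend on $n$. Let $\mathcal V_n=\{\mathbf v_1,\dots,\mathbf v_{2^{B_n}}\}$ be an RVQ codebook, i.e. its entries are independent isotropically distributed unit vectors of $\mathbb C^{N_n}$ (unit norm, law invariant under all unitary maps), and let it be independent of $(\mathbf S_n,\mathbf u_1,\dots,\mathbf u_{N_n})$. Let $\tilde{\mathbf v}_1$ be an entry that maximizes $|\mathbf u_1^\dagger\mathbf v_j|^2$ over the codebook, and put $$Q_n=\sum_{i=2}^{N_n}\lambda_i|\tilde{\mathbf v}_1^\dagger\mathbf u_i|^2 .$$ All the random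 objects live on one probability space; nothing is assumed on their joint law for different $n$. Let $\nu$ be a deterministic probability measure on $\mathbb R$, the asymptotic eigenvalue distribution, written $d\nu=g(\lambda)\,d\lambda$ with $g$ the asymptotic eigenvalue density (point masses are allowed, e.g. at $0$, where they are unavoidable if $\bar K<1$). (a) Suppose that the empirical eigenvalue distribution of $\mathbf S_n\mathbf S_n^\dagger$ converges weakly to $\nu$ in probability, i.e. $\frac1{N_n}\sum_i f(\lambda_i)\to\int f\,d\nu$ in probability for every bounded continuous $f$, and that the eigenvalues $\lambda_i$, $i\ge2$, are asymptotically uniformly integrable in probability: for all $\varepsilon,\delta>0$ there is an $R$ such that $\Pr\{\frac1{N_n}\sum_{i\ge2,\ \lambda_i>R}\lambda_i\ge\varepsilon\}\le\delta$ for all large $n$. Then $\int_0^\infty\lambda\,d\nu(\lambda)<\infty$ and, in probability, $$Q_n\to 2^{-\bar B}\int_0^\infty\lambda\,d\nu(\lambda)=2^{-\bar B}\int_0^\infty\lambda\,g(\lambda)\,d\lambda .$$ (b) Suppose that $N_n$ is strictly increasing and that, almost surely, the empirical eigenvalue distribution converges weakly to $\nu$; for every $\varepsilon>0$ there is an $R$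 such that $\frac1{N_n}\sum_{i\ge2,\ \lambda_i>R}\lambda_i\le\varepsilon$ for all large $n$; and $\lambda_2=o(N_n/\log N_n)$. Then $\int_0^\infty\lambda\,d\nu(\lambda)<\infty$ and the convergence of $Q_n$ to the same limit holds almost surely. -/

import Mathlib

open MeasureTheory ProbabilityTheory Filter Topology
open scoped BoundedContinuousFunction

/-- Complex column vectors of length `N`, with the Euclidean norm and inner product. -/
abbrev CVec (N : ℕ) : Type := EuclideanSpace ℂ (Fin N)

/-- `A = ∑ i, ev i • u i (u i)ᴴ` with orthonormal `u` and eigenvalues listed in decreasing order,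
so that index `0` carries a principal eigenpair. -/
def IsSpectralDecomp {N : ℕ} (A : Matrix (Fin N) (Fin N) ℂ) (ev : Fin N → ℝ)
    (u : Fin N → CVec N) : Prop :=
  Antitone ev ∧ Orthonormal ℂ u ∧
    A = ∑ i, (ev i : ℂ) • Matrix.vecMulVec (u i).ofLp (star (u i).ofLp)

/-- The law of an isotropically distributed unit-norm vector of `ℂ^N`: it is carried by the unit
sphere and is invariant under every unitary map. -/
def IsIsotropicUnit {N : ℕ} (μ : Measure (CVec N)) : Prop :=
  (∀ᵐ v ∂μ, ‖v‖ = 1) ∧ ∀ U : CVec N ≃ₗᵢ[ℂ] CVec N, μ.map U = μ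

/-- A random vector quantization codebook with `M` entries: independent, isotropically distributed
unit-norm vectors. -/
def IsRVQCodebook {Ω : Type*} [MeasurableSpace Ω] (P : Measure Ω) {N M : ℕ}
    (V : Fin M → Ω → CVec N) : Prop :=
  (∀ j, Measurable (V j)) ∧ iIndepFun V P ∧ ∀ j, IsIsotropicUnit (P.map (V j))

/-- `j` is the index of a codebook entry that is closest in angle to `w`. -/
def IsClosestInAngle {N M : ℕ} (w : CVec N) (C : Fin M → CVec N) (j : Fin M) : Prop :=
  ∀ k, ‖inner ℂ w (C k)‖ ^ 2 ≤ ‖inner ℂ w (C j)‖ ^ 2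

/-- The off-principal part `∑_{i ≥ 2} ev_i |vᴴ u_i|²` of the quadratic form at `v`
(the principal index is `0` here). -/
noncomputable def offPrincipal {N : ℕ} (ev : Fin N → ℝ) (u : Fin N → CVec N) (v : CVec N) : ℝ :=
  ∑ i ∈ Finset.univ.filter (fun i : Fin N => (i : ℕ) ≠ 0), ev i * ‖inner ℂ v (u i)‖ ^ 2

/-- The integral of `f` against the empirical distribution of the eigenvalues. -/
noncomputable def spectralMean {N : ℕ} (ev : Fin N → ℝ) (f : ℝ → ℝ) : ℝ :=
  (∑ i, f (ev i)) / N

/-- The part of `(1/N) ∑_{i ≥ 2} ev_i` that comes from eigenvalues above `R`. -/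
noncomputable def spectralTail {N : ℕ} (ev : Fin N → ℝ) (R : ℝ) : ℝ :=
  (∑ i ∈ Finset.univ.filter (fun i : Fin N => (i : ℕ) ≠ 0 ∧ R < ev i), ev i) / N

section Convergence

variable {Ω : Type*} [MeasurableSpace Ω] (P : Measure Ω) {N : ℕ → ℕ}
  (ev : (n : ℕ) → Ω → Fin (N n) → ℝ)

/-- The empirical eigenvalue distributions converge weakly, in probability, to `ν`. -/
def SpectrumTendstoInProb (ν : Measure ℝ) : Prop :=
  ∀ f : ℝ →ᵇ ℝ,
    TendstoInMeasure P (fun n ω => spectralMean (ev n ω) f) atTop (fun _ => ∫ x, f x ∂ν)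

/-- The empirical eigenvalue distributions converge weakly, almost surely, to `ν`. -/
def SpectrumTendstoAS (ν : Measure ℝ) : Prop :=
  ∀ᵐ ω ∂P, ∀ f : ℝ →ᵇ ℝ,
    Tendsto (fun n => spectralMean (ev n ω) f) atTop (𝓝 (∫ x, f x ∂ν))

/-- The non-principal eigenvalues are asymptotically uniformly integrable, in probability. -/
def SpectrumUIInProb : Prop :=
  ∀ ε > (0 : ℝ), ∀ δ > (0 : ℝ), ∃ R : ℝ, ∀ᶠ n in atTop,
    P {ω | ε ≤ spectralTail (ev n ω) R} ≤ ENNReal.ofReal δ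

/-- The non-principal eigenvalues are asymptotically uniformly integrable, almost surely. -/
def SpectrumUIAS : Prop :=
  ∀ᵐ ω ∂P, ∀ ε > (0 : ℝ), ∃ R : ℝ, ∀ᶠ n in atTop, spectralTail (ev n ω) R ≤ ε

/-- Almost surely, the largest non-principal eigenvalue is `o(N / log N)`. -/
def SpectrumGrowthAS : Prop :=
  ∀ᵐ ω ∂P, ∀ ε > (0 : ℝ), ∀ᶠ n in atTop, ∀ i : Fin (N n), (i : ℕ) ≠ 0 →
    ev n ω i * Real.log (N n) ≤ ε * N n

end Convergence

/-! Condition on the matrix. The squared coordinates of an isotropic unit vector in the eigenbasis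
are distributed like normalized independent exponentials `e i / ∑ k, e k`
(`IsIsotropicUnit.map_norm_sq_inner`). Hence the mass `r` off the principal direction satisfies `P(r
≤ s) = s ^ (N - 1)`, and the smallest such mass among `2 ^ B` entries is close to `2 ^ (-B / (N -
1))`, which tends to `2 ^ (-Bbar)`. The remaining mass is spread evenly over the other eigenvectors,
so the quadratic form is close to `r` times the mean of the non-principal eigenvalues. Weak
convergence and uniform integrability send that mean to `∫ λ dν`.

The selected entry depends on the whole codebook, so the deviation must be controlled for all
entries, of which there are exponentially many. The point of `pi_expMeasure_one_deviation` is that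
it bounds deviation jointly with `r ≤ s`, by `s ^ (N - 1)` times a Chernoff factor. With `s` chosen
so that `2 ^ B * s ^ (N - 1) ≤ T`, the union bound costs only `T` (`pi_atypicalCodebooks_le`). The
Chernoff exponent is of order `N / L` when the non-principal eigenvalues are at most `L` and `L` is
large. In probability, constant `T` and `L = κ N` suffice, and uniform integrability supplies such
an `L`. Almost surely, `T = 2 log N` and `L = γ N / log N` give summable errors for Borel–Cantelli.
-/

/-! ### Uniqueness of the isotropic law on the unit sphere. -/

section IsotropicLaw

/-- The unitary maps act transitively on the spheres of `ℂ^N`. -/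
theorem exists_linearIsometryEquiv_apply_eq {N : ℕ} {x y : CVec N} (h : ‖x‖ = ‖y‖) :
    ∃ U : CVec N ≃ₗᵢ[ℂ] CVec N, U x = y := by
  rcases eq_or_ne x 0 with rfl | hx
  · refine ⟨LinearIsometryEquiv.refl ℂ _, ?_⟩
    rw [norm_zero] at h
    simp [norm_eq_zero.1 h.symm]
  have hx' : ‖x‖ ≠ 0 := norm_ne_zero_iff.2 hx
  have hNpos : 0 < N := by
    rcases Nat.eq_zero_or_pos N with rfl | h0
    · exact absurd (Subsingleton.elim x 0) hx
    · exact h0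
  let i0 : Fin N := ⟨0, hNpos⟩
  have key : ∀ z : CVec N, ‖z‖ = ‖x‖ →
      ∃ b : OrthonormalBasis (Fin N) ℂ (CVec N), b i0 = ((‖x‖ : ℂ)⁻¹ • z) := by
    intro z hz
    have ho : Orthonormal ℂ (({i0} : Set (Fin N)).domRestrict fun _ => ((‖x‖ : ℂ)⁻¹ • z)) := by
      constructor
      · intro i
        simp [Set.domRestrict, norm_smul, hz, hx']
      · intro i j hij
        exact absurd (Subsingleton.elim i j) hij
    obtain ⟨b, hb⟩ := ho.exists_orthonormalBasis_extension_of_card_eq (by simp)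
    exact ⟨b, hb i0 rfl⟩
  obtain ⟨b, hb⟩ := key x rfl
  obtain ⟨b', hb'⟩ := key y h.symm
  refine ⟨b.equiv b' (Equiv.refl _), ?_⟩
  have hc : (‖x‖ : ℂ) ≠ 0 := by exact_mod_cast hx'
  have hxe : x = (‖x‖ : ℂ) • b i0 := by rw [hb, smul_smul, mul_inv_cancel₀ hc, one_smul]
  have hye : y = (‖x‖ : ℂ) • b' i0 := by rw [hb', smul_smul, mul_inv_cancel₀ hc, one_smul]
  calc (b.equiv b' (Equiv.refl _)) x
      = (b.equiv b' (Equiv.refl _)) ((‖x‖ : ℂ) • b i0) := by rw [← hxe]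
    _ = (‖x‖ : ℂ) • b' i0 := by
        rw [map_smul, OrthonormalBasis.equiv_apply_basis]; simp
    _ = y := hye.symm

/-- Characteristic functions are built on the real inner product; polarization recovers it from the
norm, which `U` preserves. -/
theorem real_inner_map_linearIsometryEquiv {N : ℕ} (U : CVec N ≃ₗᵢ[ℂ] CVec N) (x y : CVec N) :
    inner ℝ (U x) y = inner ℝ x (U.symm y) := by
  have h : ∀ a b : CVec N, inner ℝ (U a) (U b) = inner ℝ a b := by
    intro a b
    rw [real_inner_eq_norm_add_mul_self_sub_norm_mul_self_sub_norm_mul_self_div_two,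
      real_inner_eq_norm_add_mul_self_sub_norm_mul_self_sub_norm_mul_self_div_two a b,
      ← map_add, U.norm_map, U.norm_map, U.norm_map]
  rw [← h x, U.apply_symm_apply]

theorem charFun_map_linearIsometryEquiv {N : ℕ} (μ : Measure (CVec N))
    (U : CVec N ≃ₗᵢ[ℂ] CVec N) (t : CVec N) :
    charFun (μ.map U) t = charFun μ (U.symm t) := by
  rw [charFun_apply, charFun_apply, integral_map U.continuous.aemeasurable
    (by fun_prop)]
  simp_rw [real_inner_map_linearIsometryEquiv]

/-- There is only one isotropic probability law on the unit sphere of `ℂ^N`. -/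
theorem IsIsotropicUnit.eq {N : ℕ} {μ ν : Measure (CVec N)} [IsProbabilityMeasure μ]
    [IsProbabilityMeasure ν] (hμ : IsIsotropicUnit μ) (hν : IsIsotropicUnit ν) : μ = ν := by
  -- By transitivity on spheres, `charFun ρ t` depends only on `‖t‖`, so the direction of `t` may be
  -- averaged under the other law. The resulting double integral is symmetric in the two laws, and
  -- Fubini finishes.
  have key : ∀ (ρ ρ' : Measure (CVec N)) [IsProbabilityMeasure ρ] [IsProbabilityMeasure ρ'],
      IsIsotropicUnit ρ → IsIsotropicUnit ρ' → ∀ t : CVec N,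
      charFun ρ t = ∫ y, ∫ x, Complex.exp (((‖t‖ * inner ℝ x y : ℝ) : ℂ) * Complex.I) ∂ρ ∂ρ' := by
    intro ρ ρ' _ _ hρ hρ' t
    have h1 : ∀ᵐ y ∂ρ', charFun ρ t =
        ∫ x, Complex.exp (((‖t‖ * inner ℝ x y : ℝ) : ℂ) * Complex.I) ∂ρ := by
      filter_upwards [hρ'.1] with y hy
      obtain ⟨U, hU⟩ := exists_linearIsometryEquiv_apply_eq (x := t) (y := ‖t‖ • y)
        (by rw [norm_smul, hy]; simp)
      have h2 := charFun_map_linearIsometryEquiv ρ U (‖t‖ • y)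
      rw [hρ.2 U, ← hU, U.symm_apply_apply, hU] at h2
      rw [← h2, charFun_apply]
      simp_rw [real_inner_smul_right]
    rw [← integral_congr_ae h1]
    simp
  apply Measure.ext_of_charFun
  funext t
  rw [key μ ν hμ hν t, key ν μ hν hμ t, integral_integral_swap]
  · simp_rw [real_inner_comm]
  · apply Integrable.of_bound (C := 1)
    · exact (by fun_prop : Continuous _).aestronglyMeasurable
    · refine Filter.Eventually.of_forall fun p => ?_
      simp only [Function.uncurry]
      rw [Complex.norm_exp_ofReal_mul_I]

end IsotropicLaw

/-! ### Gaussian model of the isotropic law. -/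

section ComplexGaussian

/-- The circularly symmetric complex Gaussian law on `ℂ` with `E|z|² = 1`. -/
noncomputable def complexGaussian : Measure ℂ :=
  volume.withDensity fun z => ENNReal.ofReal (Real.pi⁻¹ * Real.exp (-‖z‖ ^ 2))

theorem integral_complexGaussian (f : ℂ → ℂ) :
    ∫ z, f z ∂complexGaussian = (Real.pi : ℂ)⁻¹ * ∫ z, Complex.exp (-(‖z‖ : ℂ) ^ 2) * f z := by
  rw [complexGaussian, integral_withDensity_eq_integral_toReal_smul (by fun_prop) (by simp),
    ← integral_const_mul]
  refine integral_congr_ae (Filter.Eventually.of_forall fun z => ?_)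
  simp only
  rw [ENNReal.toReal_ofReal (by positivity), Complex.real_smul]
  push_cast
  ring

theorem integral_exp_sq_complexGaussian {b : ℂ} (hb : b.re < 1) :
    ∫ z, Complex.exp (b * (‖z‖ : ℂ) ^ 2) ∂complexGaussian = (1 - b)⁻¹ := by
  rw [integral_complexGaussian]
  have h := GaussianFourier.integral_cexp_neg_mul_sq_norm (V := ℂ) (b := 1 - b) (by simpa using hb)
  simp_rw [← Complex.exp_add]
  have h2 : ∀ z : ℂ, -(‖z‖ : ℂ) ^ 2 + b * (‖z‖ : ℂ) ^ 2 = -(1 - b) * (‖z‖ : ℂ) ^ 2 := by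
    intro z; ring
  simp_rw [h2]
  rw [h]
  have hpi : (Real.pi : ℂ) ≠ 0 := by exact_mod_cast Real.pi_ne_zero
  simp only [Complex.finrank_real_complex]
  norm_num
  rw [div_eq_mul_inv, ← mul_assoc, inv_mul_cancel₀ hpi, one_mul]

instance : IsProbabilityMeasure complexGaussian := by
  have h := integral_exp_sq_complexGaussian (b := 0) (by simp)
  simp only [zero_mul, Complex.exp_zero, sub_zero, inv_one] at h
  rw [integral_const] at h
  constructor
  have h1 : complexGaussian.real Set.univ = 1 := by simpa using h
  rw [Measure.real, ENNReal.toReal_eq_one_iff] at h1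
  exact h1

theorem charFun_complexGaussian (t : ℂ) :
    charFun complexGaussian t = Complex.exp (-(‖t‖ : ℂ) ^ 2 / 4) := by
  rw [charFun_apply, integral_complexGaussian]
  have h := GaussianFourier.integral_cexp_neg_mul_sq_norm_add (V := ℂ) (b := 1) (by simp)
    Complex.I t
  simp_rw [← Complex.exp_add]
  have h2 : ∀ z : ℂ, -(‖z‖ : ℂ) ^ 2 + ((inner ℝ z t : ℝ) : ℂ) * Complex.I
      = -1 * (‖z‖ : ℂ) ^ 2 + Complex.I * ((inner ℝ t z : ℝ) : ℂ) := by
    intro z; rw [real_inner_comm]; ring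
  simp_rw [h2]
  rw [h]
  have hpi : (Real.pi : ℂ) ≠ 0 := by exact_mod_cast Real.pi_ne_zero
  simp only [Complex.finrank_real_complex]
  norm_num [inv_mul_cancel_left₀ hpi]

instance : NullSingletonClass complexGaussian := by
  unfold complexGaussian; infer_instance

/-- The Gaussian law on `ℂ^N` with independent entries. -/
noncomputable def complexGaussianVec (N : ℕ) : Measure (CVec N) :=
  (Measure.pi fun _ : Fin N => complexGaussian).map (WithLp.toLp 2)

instance (N : ℕ) : IsProbabilityMeasure (complexGaussianVec N) :=
  Measure.isProbabilityMeasure_map (by fun_prop)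

/-- Independence turns the transform into a product of Gaussians, which depends on `t` only through
its norm; unitary invariance follows from this. -/
theorem charFun_complexGaussianVec {N : ℕ} (t : CVec N) :
    charFun (complexGaussianVec N) t = Complex.exp (-(‖t‖ : ℂ) ^ 2 / 4) := by
  rw [charFun_apply, complexGaussianVec, integral_map (by fun_prop) (by fun_prop)]
  have h1 : ∀ x : Fin N → ℂ,
      Complex.exp (((inner ℝ (WithLp.toLp 2 x : CVec N) t : ℝ) : ℂ) * Complex.I)
      = ∏ i, Complex.exp (((inner ℝ (x i) (t i) : ℝ) : ℂ) * Complex.I) := by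
    intro x
    rw [← Complex.exp_sum, PiLp.inner_apply, ← Finset.sum_mul]
    push_cast
    rfl
  simp_rw [h1]
  rw [integral_fintype_prod_eq_prod
    (f := fun i (z : ℂ) => Complex.exp (((inner ℝ z (t i) : ℝ) : ℂ) * Complex.I))]
  simp_rw [← charFun_apply, charFun_complexGaussian]
  rw [← Complex.exp_sum]
  congr 1
  have := EuclideanSpace.norm_sq_eq t
  have h3 : (‖t‖ : ℂ) ^ 2 = ∑ i, (‖t i‖ : ℂ) ^ 2 := by exact_mod_cast this
  rw [h3, ← Finset.sum_neg_distrib, Finset.sum_div]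

theorem map_complexGaussianVec {N : ℕ} (U : CVec N ≃ₗᵢ[ℂ] CVec N) :
    (complexGaussianVec N).map U = complexGaussianVec N := by
  have : IsProbabilityMeasure ((complexGaussianVec N).map U) :=
    Measure.isProbabilityMeasure_map U.continuous.aemeasurable
  apply Measure.ext_of_charFun
  funext t
  rw [charFun_map_linearIsometryEquiv, charFun_complexGaussianVec, charFun_complexGaussianVec,
    U.symm.norm_map]

theorem ae_ne_zero_complexGaussianVec {N : ℕ} (hN : 0 < N) :
    ∀ᵐ x ∂complexGaussianVec N, x ≠ 0 := by
  have h0 : MeasurableSet {x : CVec N | x ≠ 0} := (measurableSet_singleton 0).compl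
  rw [complexGaussianVec, ae_map_iff (by fun_prop) h0]
  have h1 : ∀ᵐ z ∂complexGaussian, z ≠ 0 := by
    simp [ae_iff]
  filter_upwards [(Measure.quasiMeasurePreserving_eval (fun _ : Fin N => complexGaussian)
    ⟨0, hN⟩).ae h1] with x hx h0
  apply hx
  have := congrArg (fun v : CVec N => v ⟨0, hN⟩) h0
  simpa using this

/-- By uniqueness of the isotropic law, this concrete model may replace any isotropic unit vector.
-/
theorem isIsotropicUnit_map_normalize {N : ℕ} (hN : 0 < N) :
    IsIsotropicUnit ((complexGaussianVec N).map fun x => ‖x‖⁻¹ • x) := by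
  have hm : Measurable fun x : CVec N => ‖x‖⁻¹ • x := by fun_prop
  constructor
  · rw [ae_map_iff hm.aemeasurable (measurableSet_eq_fun (by fun_prop) (by fun_prop))]
    filter_upwards [ae_ne_zero_complexGaussianVec hN] with x hx
    rw [norm_smul, norm_inv, norm_norm, inv_mul_cancel₀ (norm_ne_zero_iff.2 hx)]
  · intro U
    have hU : Measurable U := U.continuous.measurable
    rw [Measure.map_map hU hm]
    conv_rhs => rw [← map_complexGaussianVec U, Measure.map_map hm hU]
    congr 1
    funext x
    simp only [Function.comp, U.norm_map]
    exact (U.toLinearEquiv.toLinearMap.restrictScalars ℝ).map_smul _ _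

theorem expMeasure_one : expMeasure 1 =
    (volume.restrict (Set.Ioi 0)).withDensity fun x => ENNReal.ofReal (Real.exp (-x)) := by
  rw [expMeasure, gammaMeasure, ← withDensity_indicator measurableSet_Ioi]
  refine withDensity_congr_ae ?_
  have h0 : ∀ᵐ x : ℝ, x ≠ 0 := by simp [ae_iff]
  filter_upwards [h0] with x hx
  change exponentialPDF 1 x = _
  rw [exponentialPDF_eq, Set.indicator]
  rcases lt_or_gt_of_ne hx with h | h
  · simp [not_le.2 h, not_lt.2 h.le]
  · simp [h, h.le]

instance : IsProbabilityMeasure (expMeasure 1) := isProbabilityMeasure_expMeasure one_pos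

theorem integral_exp_expMeasure_one {b : ℂ} (hb : b.re < 1) :
    ∫ x, Complex.exp (b * (x : ℂ)) ∂expMeasure 1 = (1 - b)⁻¹ := by
  rw [expMeasure_one, integral_withDensity_eq_integral_toReal_smul (by fun_prop) (by simp)]
  have h1 : ∀ x : ℝ, (ENNReal.ofReal (Real.exp (-x))).toReal • Complex.exp (b * (x : ℂ))
      = Complex.exp ((b - 1) * x) := by
    intro x
    rw [ENNReal.toReal_ofReal (Real.exp_pos _).le, Complex.real_smul, Complex.ofReal_exp,
      ← Complex.exp_add]
    congr 1
    push_cast; ring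
  simp_rw [h1]
  rw [integral_exp_mul_complex_Ioi (by simpa using hb)]
  simp only [Complex.ofReal_zero, mul_zero, Complex.exp_zero]
  rw [neg_div, ← div_neg, neg_sub, one_div]

/-- Both characteristic functions equal `(1 - b)⁻¹` at `b = t * I`. -/
theorem map_norm_sq_complexGaussian :
    complexGaussian.map (fun z => ‖z‖ ^ 2) = expMeasure 1 := by
  have : IsProbabilityMeasure (complexGaussian.map fun z => ‖z‖ ^ 2) :=
    Measure.isProbabilityMeasure_map (by fun_prop)
  apply Measure.ext_of_charFun
  funext t
  rw [charFun_apply, charFun_apply, integral_map (by fun_prop) (by fun_prop)]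
  have h1 : ∀ x : ℝ, ((inner ℝ x t : ℝ) : ℂ) * Complex.I = (t * Complex.I) * (x : ℂ) := by
    intro x
    simp; ring
  simp_rw [h1]
  rw [integral_exp_expMeasure_one (by simp)]
  push_cast
  rw [integral_exp_sq_complexGaussian (by simp)]

theorem map_norm_sq_coord_complexGaussianVec (N : ℕ) :
    (complexGaussianVec N).map (fun x i => ‖x i‖ ^ 2) = Measure.pi fun _ => expMeasure 1 := by
  rw [complexGaussianVec, Measure.map_map (by fun_prop) (by fun_prop)]
  have h := Measure.pi_map_pi (μ := fun _ : Fin N => complexGaussian)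
    (f := fun _ z => ‖z‖ ^ 2)
    (hμ := fun _ => by rw [map_norm_sq_complexGaussian]; infer_instance)
    (fun _ => by fun_prop)
  simp_rw [map_norm_sq_complexGaussian] at h
  exact h

/-- The squared coordinates of an isotropic unit vector in an orthonormal basis are distributed
like normalized independent exponential variables. -/
theorem IsIsotropicUnit.map_norm_sq_inner {N : ℕ} (hN : 0 < N) {μ : Measure (CVec N)}
    [IsProbabilityMeasure μ] (hμ : IsIsotropicUnit μ) {u : Fin N → CVec N}
    (hu : Orthonormal ℂ u) :
    μ.map (fun v i => ‖inner ℂ (u i) v‖ ^ 2) =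
      (Measure.pi fun _ : Fin N => expMeasure 1).map fun e i => e i / ∑ k, e k := by
  have : Nonempty (Fin N) := ⟨⟨0, hN⟩⟩
  let b : OrthonormalBasis (Fin N) ℂ (CVec N) :=
    (basisOfOrthonormalOfCardEqFinrank hu (by simp)).toOrthonormalBasis (by simpa using hu)
  have hb : ∀ i, b i = u i := by intro i; simp [b]
  let U : CVec N ≃ₗᵢ[ℂ] CVec N := b.repr
  have hU : ∀ v i, inner ℂ (u i) v = U v i := by
    intro v i
    rw [← hb, ← b.repr_apply_apply]
  have hUm : Measurable U := U.continuous.measurable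
  have hnm : Measurable fun x : CVec N => ‖x‖⁻¹ • x := by fun_prop
  have hiso := isIsotropicUnit_map_normalize hN
  have : IsProbabilityMeasure ((complexGaussianVec N).map fun x => ‖x‖⁻¹ • x) :=
    Measure.isProbabilityMeasure_map hnm.aemeasurable
  have hsq : Measurable fun (x : CVec N) (i : Fin N) => ‖x i‖ ^ 2 := by fun_prop
  calc μ.map (fun v i => ‖inner ℂ (u i) v‖ ^ 2)
      = (μ.map U).map (fun x i => ‖x i‖ ^ 2) := by
        rw [Measure.map_map hsq hUm]
        simp_rw [hU]
        rfl
    _ = ((complexGaussianVec N).map fun x => ‖x‖⁻¹ • x).map (fun x i => ‖x i‖ ^ 2) := by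
        rw [hμ.2 U, hμ.eq hiso]
    _ = ((complexGaussianVec N).map (fun x i => ‖x i‖ ^ 2)).map
          (fun e i => e i / ∑ k, e k) := by
        rw [Measure.map_map hsq hnm, Measure.map_map (by fun_prop) hsq]
        congr 1
        funext x i
        simp only [Function.comp, PiLp.smul_apply, norm_smul, norm_inv, norm_norm, mul_pow]
        rw [← EuclideanSpace.norm_sq_eq, inv_pow, div_eq_inv_mul]
    _ = _ := by rw [map_norm_sq_coord_complexGaussianVec]

end ComplexGaussian

/-! ### Exact tail and Chernoff bounds for exponential variables. -/

section ExponentialVariables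

theorem expMeasure_one_Ici {t : ℝ} (ht : 0 ≤ t) :
    expMeasure 1 (Set.Ici t) = ENNReal.ofReal (Real.exp (-t)) := by
  rw [expMeasure_one, withDensity_apply _ measurableSet_Ici,
    Measure.restrict_restrict measurableSet_Ici]
  have h1 : (Set.Ici t ∩ Set.Ioi 0 : Set ℝ) =ᵐ[volume] Set.Ioi t := by
    have h0 : ∀ᵐ x : ℝ, x ≠ t := by simp [ae_iff]
    filter_upwards [h0] with x hx
    refine propext ⟨fun h => lt_of_le_of_ne h.1 hx.symm, fun h => ⟨le_of_lt h, ?_⟩⟩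
    exact lt_of_le_of_lt ht h
  rw [setLIntegral_congr h1, ← ofReal_integral_eq_lintegral_ofReal (integrableOn_exp_neg_Ioi t)
    (Filter.Eventually.of_forall fun x => (Real.exp_pos _).le), integral_exp_neg_Ioi]

theorem lintegral_exp_expMeasure_one {b : ℝ} (hb : b < 1) :
    ∫⁻ x, ENNReal.ofReal (Real.exp (b * x)) ∂expMeasure 1 = ENNReal.ofReal (1 - b)⁻¹ := by
  rw [expMeasure_one, lintegral_withDensity_eq_lintegral_mul _ (by fun_prop) (by fun_prop)]
  have h1 : ∀ x : ℝ, ENNReal.ofReal (Real.exp (-x)) * ENNReal.ofReal (Real.exp (b * x))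
      = ENNReal.ofReal (Real.exp ((b - 1) * x)) := by
    intro x
    rw [← ENNReal.ofReal_mul (Real.exp_pos _).le, ← Real.exp_add]
    congr 2
    ring
  simp only [Pi.mul_apply, h1]
  have hb' : b - 1 < 0 := by linarith
  rw [← ofReal_integral_eq_lintegral_ofReal (integrableOn_exp_mul_Ioi hb' 0)
    (Filter.Eventually.of_forall fun x => (Real.exp_pos _).le), integral_exp_mul_Ioi hb']
  congr 1
  rw [mul_zero, Real.exp_zero, neg_div, ← div_neg, neg_sub, one_div]

theorem ae_pos_expMeasure_one : ∀ᵐ x ∂expMeasure 1, 0 < x := by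
  rw [expMeasure_one]
  exact (withDensity_absolutelyContinuous _ _).ae_le (ae_restrict_mem measurableSet_Ioi)

theorem ae_pos_pi_expMeasure_one (m : ℕ) :
    ∀ᵐ e ∂Measure.pi (fun _ : Fin m => expMeasure 1), ∀ i, 0 < e i := by
  rw [ae_all_iff]
  intro i
  exact (Measure.quasiMeasurePreserving_eval (fun _ : Fin m => expMeasure 1) i).ae
    ae_pos_expMeasure_one

theorem lintegral_prod_exp_pi_expMeasure_one {m : ℕ} {b : Fin m → ℝ} (hb : ∀ i, b i < 1) :
    ∫⁻ e, ∏ i, ENNReal.ofReal (Real.exp (b i * e i)) ∂Measure.pi (fun _ => expMeasure 1)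
      = ENNReal.ofReal (∏ i, (1 - b i)⁻¹) := by
  have h := lintegral_prod_eq_prod_lintegral_of_indepFun
    (μ := Measure.pi (fun _ : Fin m => expMeasure 1)) Finset.univ
    (fun i e => ENNReal.ofReal (Real.exp (b i * e i)))
    (iIndepFun_pi (X := fun i x => ENNReal.ofReal (Real.exp (b i * x))) (fun i => by fun_prop))
    (fun i => by fun_prop)
  rw [h, ENNReal.ofReal_prod_of_nonneg (fun i _ => inv_nonneg.2 (by linarith [hb i]))]
  refine Finset.prod_congr rfl fun i _ => ?_
  rw [← lintegral_exp_expMeasure_one (hb i)]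
  have := (measurePreserving_eval (fun _ : Fin m => expMeasure 1) i).lintegral_comp
    (f := fun x => ENNReal.ofReal (Real.exp (b i * x))) (by fun_prop)
  exact this

/-- The event that the variables other than the first contribute at most a fraction `s` of the
total, intersected with an event about those variables. -/
theorem pi_expMeasure_one_tail {m : ℕ} {s : ℝ} (hs : 0 < s) (hs1 : s ≤ 1)
    {D : Set (Fin m → ℝ)} (hD : MeasurableSet D) :
    Measure.pi (fun _ : Fin (m + 1) => expMeasure 1)
        {e | ∑ i : Fin m, e i.succ ≤ s * ∑ k, e k ∧ (fun i : Fin m => e i.succ) ∈ D}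
      = ∫⁻ x in D, ∏ i, ENNReal.ofReal (Real.exp (-(s⁻¹ - 1) * x i))
          ∂Measure.pi (fun _ => expMeasure 1) := by
  have hc : 0 ≤ s⁻¹ - 1 := by linarith [(one_le_inv₀ hs).2 hs1]
  have hmp := measurePreserving_piFinSuccAbove (fun _ : Fin (m + 1) => expMeasure 1) 0
  let A : Set (ℝ × (Fin m → ℝ)) := {p | (s⁻¹ - 1) * ∑ i, p.2 i ≤ p.1} ∩ {p | p.2 ∈ D}
  have hA : MeasurableSet A :=
    (measurableSet_le (by fun_prop) (by fun_prop)).inter (measurable_snd hD)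
  have hset : {e : Fin (m + 1) → ℝ | ∑ i : Fin m, e i.succ ≤ s * ∑ k, e k ∧
      (fun i : Fin m => e i.succ) ∈ D} =
      MeasurableEquiv.piFinSuccAbove (fun _ : Fin (m + 1) => ℝ) 0 ⁻¹' A := by
    ext e
    -- The event is a lower bound on the first variable alone, so integrating that variable out
    -- leaves the weight `exp (-(s⁻¹ - 1) * ∑ x i)`.
    have : (∑ i : Fin m, e i.succ ≤ s * ∑ k, e k) ↔
        (s⁻¹ - 1) * ∑ i : Fin m, e i.succ ≤ e 0 := by
      rw [Fin.sum_univ_succ, ← mul_le_mul_iff_right₀ (inv_pos.2 hs), ← mul_assoc,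
        inv_mul_cancel₀ hs.ne', one_mul]
      constructor <;> intro h <;> linarith
    simp only [Set.mem_ofPred_eq, this]
    rfl
  rw [hset, hmp.measure_preimage hA.nullMeasurableSet, Measure.prod_apply_symm hA,
    ← lintegral_indicator hD]
  refine lintegral_congr_ae ?_
  filter_upwards [ae_pos_pi_expMeasure_one m] with x hx
  by_cases hxD : x ∈ D
  · have h1 : (fun y : ℝ => (y, x)) ⁻¹' A = Set.Ici ((s⁻¹ - 1) * ∑ i, x i) := by
      ext y; simp [A, hxD]
    rw [h1, expMeasure_one_Ici (mul_nonneg hc (Finset.sum_nonneg fun i _ => (hx i).le)),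
      Set.indicator_of_mem hxD, ← ENNReal.ofReal_prod_of_nonneg
        (fun i _ => (Real.exp_pos _).le), ← Real.exp_sum, ← Finset.mul_sum, neg_mul]
  · have h1 : (fun y : ℝ => (y, x)) ⁻¹' A = ∅ := by
      ext y; simp [A, hxD]
    rw [h1, Set.indicator_of_notMem hxD, measure_empty]

/-- Each of the `m` other variables contributes `E exp (-(s⁻¹ - 1) x) = s`; this is the Beta(`m`, 1)
distribution function. -/
theorem pi_expMeasure_one_fraction_le {m : ℕ} {s : ℝ} (hs : 0 < s) (hs1 : s ≤ 1) :
    Measure.pi (fun _ : Fin (m + 1) => expMeasure 1)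
        {e | ∑ i : Fin m, e i.succ ≤ s * ∑ k, e k} = ENNReal.ofReal (s ^ m) := by
  have h := pi_expMeasure_one_tail hs hs1 (m := m) MeasurableSet.univ
  simp only [Set.mem_univ, and_true, Measure.restrict_univ] at h
  have hc : 0 ≤ s⁻¹ - 1 := by linarith [(one_le_inv₀ hs).2 hs1]
  rw [h, lintegral_prod_exp_pi_expMeasure_one (fun _ => by linarith)]
  simp

/-- The weight from the first variable makes the others exponential of rate `s⁻¹`. Tilting by `s⁻¹ *
τ` matches this scale, so the factor `s ^ m` comes out exactly and the usual Chernoff product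
remains. -/
theorem pi_expMeasure_one_chernoff {m : ℕ} {s τ : ℝ} (hs : 0 < s) (hs1 : s ≤ 1) (hτ : 0 ≤ τ)
    {a : Fin m → ℝ} (ha : ∀ i, τ * a i < 1) :
    Measure.pi (fun _ : Fin (m + 1) => expMeasure 1)
        {e | ∑ i : Fin m, e i.succ ≤ s * ∑ k, e k ∧ 0 < ∑ i : Fin m, a i * e i.succ}
      ≤ ENNReal.ofReal (s ^ m * ∏ i, (1 - τ * a i)⁻¹) := by
  let D : Set (Fin m → ℝ) := {x | 0 < ∑ i, a i * x i}
  have hD : MeasurableSet D := measurableSet_lt (by fun_prop) (by fun_prop)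
  have h := pi_expMeasure_one_tail hs hs1 hD
  refine h.trans_le ?_
  have hb : ∀ i, -(s⁻¹ - 1) + s⁻¹ * τ * a i < 1 := by
    intro i
    have := mul_lt_mul_of_pos_left (ha i) (inv_pos.2 hs)
    linarith
  have hval : (∏ i, (1 - (-(s⁻¹ - 1) + s⁻¹ * τ * a i))⁻¹) = s ^ m * ∏ i, (1 - τ * a i)⁻¹ := by
    have : s ^ m = ∏ _i : Fin m, s := by simp
    rw [this, ← Finset.prod_mul_distrib]
    refine Finset.prod_congr rfl fun i _ => ?_
    have : 1 - (-(s⁻¹ - 1) + s⁻¹ * τ * a i) = s⁻¹ * (1 - τ * a i) := by ring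
    rw [this, mul_inv, inv_inv]
  rw [← hval, ← lintegral_prod_exp_pi_expMeasure_one hb]
  refine (setLIntegral_mono' hD fun x hx => ?_).trans (setLIntegral_le_lintegral _ _)
  rw [← ENNReal.ofReal_prod_of_nonneg (fun i _ => (Real.exp_pos _).le),
    ← ENNReal.ofReal_prod_of_nonneg (fun i _ => (Real.exp_pos _).le), ← Real.exp_sum,
    ← Real.exp_sum]
  refine ENNReal.ofReal_le_ofReal (Real.exp_le_exp.2 ?_)
  have h1 : ∑ i, (-(s⁻¹ - 1) + s⁻¹ * τ * a i) * x i
      = ∑ i, -(s⁻¹ - 1) * x i + s⁻¹ * τ * ∑ i, a i * x i := by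
    rw [Finset.mul_sum, ← Finset.sum_add_distrib]
    exact Finset.sum_congr rfl fun i _ => by ring
  rw [h1]
  have : 0 ≤ s⁻¹ * τ * ∑ i, a i * x i :=
    mul_nonneg (mul_nonneg (inv_pos.2 hs).le hτ) (le_of_lt hx)
  linarith

end ExponentialVariables

/-! ### Concentration of weighted sums of exponentials. -/

section Deviation

theorem inv_one_sub_le_exp {x : ℝ} (hx : |x| ≤ 1 / 2) : (1 - x)⁻¹ ≤ Real.exp (x + x ^ 2) := by
  obtain ⟨h1, h2⟩ := abs_le.1 hx
  rw [inv_le_iff_one_le_mul₀ (by linarith)]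
  rcases le_total x 0 with h | h
  · have := Real.add_one_le_exp (x + x ^ 2)
    have h3 : (x + x ^ 2 + 1) * (1 - x) ≤ Real.exp (x + x ^ 2) * (1 - x) :=
      mul_le_mul_of_nonneg_right this (by linarith)
    nlinarith [mul_nonneg (neg_nonneg.2 h) (sq_nonneg x)]
  · have := Real.quadratic_le_exp_of_nonneg (x := x + x ^ 2) (by positivity)
    have h3 := mul_le_mul_of_nonneg_right this (show 0 ≤ 1 - x by linarith)
    have h4 : 0 ≤ x ^ 2 * ((1 - x) * (1 + x) ^ 2 / 2 - x) := by
      apply mul_nonneg (sq_nonneg x)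
      nlinarith [mul_nonneg h (show 0 ≤ 1 / 2 - x by linarith),
        mul_nonneg (mul_nonneg h h) (show 0 ≤ 1 / 2 - x by linarith)]
    nlinarith

/-- The value of `τ * D` makes the second-order term at most half of the linear gain `τ * m * ε`,
and keeps every `|τ * a i|` below `1 / 2`, where the quadratic bound is valid. -/
theorem prod_inv_one_sub_le_exp {m : ℕ} {τ D ε C : ℝ} {a : Fin m → ℝ} (hτ : 0 < τ) (hε : 0 < ε)
    (hC : 0 ≤ C) (hD : 0 < D) (hτD : τ * D = ε / (2 * (C + ε))) (haD : ∀ i, |a i| ≤ D)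
    (hsum : ∑ i, a i = -(m * ε)) (hsq : ∑ i, a i ^ 2 ≤ m * ((C + ε) * D)) :
    ∏ i, (1 - τ * a i)⁻¹ ≤ Real.exp (-(ε ^ 2 * m / (4 * (C + ε) * D))) := by
  have hle : ∀ i, |τ * a i| ≤ 1 / 2 := by
    intro i
    rw [abs_mul, abs_of_pos hτ]
    calc τ * |a i| ≤ τ * D := mul_le_mul_of_nonneg_left (haD i) hτ.le
      _ = ε / (2 * (C + ε)) := hτD
      _ ≤ 1 / 2 := by
        rw [div_le_div_iff₀ (by positivity) (by norm_num)]
        nlinarith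
  have h1 : ∏ i, (1 - τ * a i)⁻¹ ≤ ∏ i, Real.exp (τ * a i + (τ * a i) ^ 2) := by
    refine Finset.prod_le_prod (fun i _ => ?_) fun i _ => inv_one_sub_le_exp (hle i)
    exact inv_nonneg.2 (by linarith [(abs_le.1 (hle i)).2])
  refine h1.trans ?_
  rw [← Real.exp_sum]
  refine Real.exp_le_exp.2 ?_
  have h2 : ∑ i, (τ * a i + (τ * a i) ^ 2) = τ * ∑ i, a i + τ ^ 2 * ∑ i, a i ^ 2 := by
    rw [Finset.mul_sum, Finset.mul_sum, ← Finset.sum_add_distrib]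
    exact Finset.sum_congr rfl fun i _ => by ring
  have h3 : τ ^ 2 * ∑ i, a i ^ 2 ≤ τ * m * ε / 2 := by
    calc τ ^ 2 * ∑ i, a i ^ 2 ≤ τ ^ 2 * (m * ((C + ε) * D)) :=
          mul_le_mul_of_nonneg_left hsq (sq_nonneg τ)
      _ = (τ * D) * (τ * m * (C + ε)) := by ring
      _ = τ * m * ε / 2 := by
        rw [hτD]
        have : C + ε ≠ 0 := by positivity
        field_simp
  have h4 : τ = ε / (2 * (C + ε)) / D := by rw [← hτD]; field_simp
  have h5 : ε ^ 2 * m / (4 * (C + ε) * D) = τ * m * ε / 2 := by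
    rw [h4]; field_simp; ring
  rw [h2, hsum, h5]
  linarith

/-- Concentration of `∑ ev_i e_i` around the mean of `ev`, jointly with the event that the first
variable dominates. -/
theorem pi_expMeasure_one_deviation {m : ℕ} {s ε C L lam : ℝ} (hs : 0 < s) (hs1 : s ≤ 1)
    (hε : 0 < ε) {ev : Fin m → ℝ} (hev : ∀ i, 0 ≤ ev i) (hL0 : 0 ≤ L) (hL : ∀ i, ev i ≤ L)
    (hlam0 : 0 ≤ lam) (hlam : ∑ i, ev i = m * lam) (hC : lam ≤ C) :
    Measure.pi (fun _ : Fin (m + 1) => expMeasure 1)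
        {e | ∑ i : Fin m, e i.succ ≤ s * ∑ k, e k ∧
          ε * ∑ i : Fin m, e i.succ < |∑ i : Fin m, ev i * e i.succ
            - lam * ∑ i : Fin m, e i.succ|}
      ≤ ENNReal.ofReal
          (s ^ m * (2 * Real.exp (-(ε ^ 2 * m / (4 * (C + ε) * (L + C + ε)))))) := by
  have hC0 : 0 ≤ C := hlam0.trans hC
  have hD : 0 < L + C + ε := by positivity
  let D := L + C + ε
  let τ := ε / (2 * (C + ε)) / D
  have hτ : 0 < τ := by positivity
  have hτD : τ * D = ε / (2 * (C + ε)) := div_mul_cancel₀ _ hD.ne'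
  -- Using `∑ ev i ^ 2 ≤ L * ∑ ev i` gives `L * C` instead of `L ^ 2`. The exponent then decays only
  -- like `m / L`, which allows `L` to grow almost as fast as `m`.
  have hsqv : ∑ i, (ev i - lam) ^ 2 ≤ m * (L * C) := by
    have h1 : ∑ i, (ev i - lam) ^ 2 = ∑ i, ev i ^ 2 - m * lam ^ 2 := by
      have h2 : ∀ i, (ev i - lam) ^ 2 = ev i ^ 2 - 2 * lam * ev i + lam ^ 2 := fun i => by ring
      simp_rw [h2]
      rw [Finset.sum_add_distrib, Finset.sum_sub_distrib, ← Finset.mul_sum, hlam]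
      simp
      ring
    have h3 : ∑ i, ev i ^ 2 ≤ ∑ i, L * ev i := by
      refine Finset.sum_le_sum fun i _ => ?_
      rw [sq]
      exact mul_le_mul_of_nonneg_right (hL i) (hev i)
    rw [← Finset.mul_sum, hlam] at h3
    have h4 : (m : ℝ) * (L * lam) ≤ m * (L * C) := by gcongr
    have h5 : 0 ≤ (m : ℝ) * lam ^ 2 := by positivity
    nlinarith
  have hsq : ∀ σ : ℝ, σ ^ 2 = 1 → ∑ i, (σ * (ev i - lam) - ε) ^ 2 ≤ m * ((C + ε) * D) := by
    intro σ hσ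
    have h1 : ∑ i, (σ * (ev i - lam) - ε) ^ 2 = ∑ i, (ev i - lam) ^ 2 + m * ε ^ 2 := by
      have h2 : ∀ i, (σ * (ev i - lam) - ε) ^ 2
          = (ev i - lam) ^ 2 - 2 * ε * σ * (ev i - lam) + ε ^ 2 := by
        intro i
        have : (σ * (ev i - lam) - ε) ^ 2
          = σ ^ 2 * (ev i - lam) ^ 2 - 2 * ε * σ * (ev i - lam) + ε ^ 2 := by ring
        rw [this, hσ, one_mul]
      simp_rw [h2]
      rw [Finset.sum_add_distrib, Finset.sum_sub_distrib, ← Finset.mul_sum,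
        Finset.sum_sub_distrib, hlam]
      simp
    rw [h1]
    have h3 : L * C + ε ^ 2 ≤ (C + ε) * D := by
      have : 0 ≤ L * ε := by positivity
      have : 0 ≤ C * ε := by positivity
      simp only [D]
      nlinarith [sq_nonneg C]
    have h4 := mul_le_mul_of_nonneg_left h3 (Nat.cast_nonneg (α := ℝ) m)
    linarith
  have habs : ∀ σ : ℝ, |σ| = 1 → ∀ i, |σ * (ev i - lam) - ε| ≤ D := by
    intro σ hσ i
    have h1 : |ev i - lam| ≤ L + C := abs_le.2
      ⟨by linarith [hev i], by linarith [hL i]⟩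
    calc |σ * (ev i - lam) - ε| ≤ |σ * (ev i - lam)| + |ε| := abs_sub _ _
      _ ≤ D := by
        rw [abs_mul, hσ, one_mul, abs_of_pos hε]
        linarith
  -- The sign `σ` selects the upper or lower deviation; subtracting `ε` from each weight turns
  -- exceedance into positivity of a weighted sum.
  have hside : ∀ σ : ℝ, |σ| = 1 →
      Measure.pi (fun _ : Fin (m + 1) => expMeasure 1)
        {e | ∑ i : Fin m, e i.succ ≤ s * ∑ k, e k ∧
          0 < ∑ i : Fin m, (σ * (ev i - lam) - ε) * e i.succ}
      ≤ ENNReal.ofReal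
          (s ^ m * Real.exp (-(ε ^ 2 * m / (4 * (C + ε) * (L + C + ε))))) := by
    intro σ hσ
    have hσ2 : σ ^ 2 = 1 := by rw [← sq_abs, hσ, one_pow]
    have hsum : ∑ i, (σ * (ev i - lam) - ε) = -(m * ε) := by
      rw [Finset.sum_sub_distrib, ← Finset.mul_sum, Finset.sum_sub_distrib, hlam]
      simp
    have hb := prod_inv_one_sub_le_exp hτ hε hC0 hD hτD (habs σ hσ) hsum (hsq σ hσ2)
    refine (pi_expMeasure_one_chernoff hs hs1 hτ.le fun i => ?_).trans
      (ENNReal.ofReal_le_ofReal (mul_le_mul_of_nonneg_left hb (by positivity)))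
    calc τ * (σ * (ev i - lam) - ε) ≤ τ * D :=
          mul_le_mul_of_nonneg_left ((le_abs_self _).trans (habs σ hσ i)) hτ.le
      _ = ε / (2 * (C + ε)) := hτD
      _ < 1 := by
        rw [div_lt_one (by positivity)]
        linarith
  have hexp : ∀ (σ : ℝ) (e : Fin (m + 1) → ℝ),
      ∑ i : Fin m, (σ * (ev i - lam) - ε) * e i.succ
        = σ * (∑ i : Fin m, ev i * e i.succ - lam * ∑ i : Fin m, e i.succ)
          - ε * ∑ i : Fin m, e i.succ := by
    intro σ e
    rw [Finset.mul_sum, Finset.mul_sum, ← Finset.sum_sub_distrib, Finset.mul_sum,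
      ← Finset.sum_sub_distrib]
    exact Finset.sum_congr rfl fun i _ => by ring
  rw [show s ^ m * (2 * Real.exp (-(ε ^ 2 * m / (4 * (C + ε) * (L + C + ε)))))
    = s ^ m * Real.exp (-(ε ^ 2 * m / (4 * (C + ε) * (L + C + ε))))
      + s ^ m * Real.exp (-(ε ^ 2 * m / (4 * (C + ε) * (L + C + ε)))) by ring,
    ENNReal.ofReal_add (by positivity) (by positivity)]
  refine le_trans (measure_mono ?_) ((measure_union_le _ _).trans
    (add_le_add (hside 1 (by simp)) (hside (-1) (by simp))))
  rintro e ⟨h1, h2⟩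
  rcases lt_abs.1 h2 with h | h
  · left
    refine ⟨h1, ?_⟩
    rw [hexp]
    linarith
  · right
    refine ⟨h1, ?_⟩
    rw [hexp]
    linarith

end Deviation

/-! ### Transfer to isotropic vectors. -/

section IsotropicVector

/-- The squared norm of the part of `v` off the principal direction. -/
noncomputable def offMass {N : ℕ} (u : Fin N → CVec N) (v : CVec N) : ℝ :=
  offPrincipal (fun _ => 1) u v

/-- The mean of the non-principal eigenvalues. -/
noncomputable def offMean {N : ℕ} (ev : Fin N → ℝ) : ℝ :=
  (∑ i ∈ Finset.univ.filter (fun i : Fin N => (i : ℕ) ≠ 0), ev i) / ((N - 1 : ℕ) : ℝ)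

theorem sum_filter_ne_zero_eq_sum_succ {m : ℕ} (f : Fin (m + 1) → ℝ) :
    ∑ i ∈ Finset.univ.filter (fun i : Fin (m + 1) => (i : ℕ) ≠ 0), f i = ∑ i : Fin m, f i.succ := by
  rw [Finset.sum_filter, Fin.sum_univ_succ]
  simp

/-- Parseval. For unit vectors, maximal overlap with the principal eigenvector therefore means
minimal off-principal mass. -/
theorem offMass_eq {N : ℕ} (hN : 0 < N) {u : Fin N → CVec N} (hu : Orthonormal ℂ u)
    (v : CVec N) : offMass u v = ‖v‖ ^ 2 - ‖inner ℂ (u ⟨0, hN⟩) v‖ ^ 2 := by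
  obtain ⟨m, rfl⟩ : ∃ m, N = m + 1 := ⟨N - 1, by omega⟩
  let b : OrthonormalBasis (Fin (m + 1)) ℂ (CVec (m + 1)) :=
    (basisOfOrthonormalOfCardEqFinrank hu (by simp)).toOrthonormalBasis (by simpa using hu)
  have hb : ∀ i, b i = u i := by intro i; simp [b]
  have h := b.sum_sq_norm_inner_right v
  simp_rw [hb] at h
  rw [← h, Fin.sum_univ_succ, offMass, offPrincipal, sum_filter_ne_zero_eq_sum_succ]
  simp_rw [one_mul, norm_inner_symm v]
  have : (⟨0, hN⟩ : Fin (m + 1)) = 0 := rfl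
  rw [this]
  ring

theorem IsIsotropicUnit.measure_offMass_le {N : ℕ} (hN : 0 < N) {μ : Measure (CVec N)}
    [IsProbabilityMeasure μ] (hμ : IsIsotropicUnit μ) {u : Fin N → CVec N}
    (hu : Orthonormal ℂ u) {s : ℝ} (hs : 0 < s) (hs1 : s ≤ 1) :
    μ {v | offMass u v ≤ s} = ENNReal.ofReal (s ^ (N - 1)) := by
  have hmap := hμ.map_norm_sq_inner hN hu
  obtain ⟨m, rfl⟩ : ∃ m, N = m + 1 := ⟨N - 1, by omega⟩
  have hA : MeasurableSet {x : Fin (m + 1) → ℝ | ∑ i : Fin m, x i.succ ≤ s} :=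
    measurableSet_le (by fun_prop) (by fun_prop)
  have h1 := congrArg (fun ρ : Measure _ => ρ {x | ∑ i : Fin m, x i.succ ≤ s}) hmap
  rw [Measure.map_apply (by fun_prop) hA, Measure.map_apply (by fun_prop) hA] at h1
  have h2 : {v | offMass u v ≤ s} = (fun v i => ‖inner ℂ (u i) v‖ ^ 2) ⁻¹'
      {x : Fin (m + 1) → ℝ | ∑ i : Fin m, x i.succ ≤ s} := by
    ext v
    simp only [Set.mem_ofPred_eq, Set.mem_preimage, offMass, offPrincipal,
      sum_filter_ne_zero_eq_sum_succ, one_mul, norm_inner_symm v]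
  rw [h2, h1, Nat.add_sub_cancel, ← pi_expMeasure_one_fraction_le hs hs1]
  refine measure_congr ?_
  filter_upwards [ae_pos_pi_expMeasure_one (m + 1)] with e he
  refine propext ?_
  change ∑ i : Fin m, e i.succ / ∑ k, e k ≤ s ↔ _
  rw [← Finset.sum_div, div_le_iff₀ (Finset.sum_pos (fun i _ => he i) Finset.univ_nonempty)]
  rfl

theorem IsIsotropicUnit.measure_deviation_le {N : ℕ} (hN : 0 < N) {μ : Measure (CVec N)}
    [IsProbabilityMeasure μ] (hμ : IsIsotropicUnit μ) {u : Fin N → CVec N}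
    (hu : Orthonormal ℂ u) {s ε C L : ℝ} (hs : 0 < s) (hs1 : s ≤ 1) (hε : 0 < ε)
    {ev : Fin N → ℝ} (hev : ∀ i, 0 ≤ ev i) (hL0 : 0 ≤ L)
    (hL : ∀ i : Fin N, (i : ℕ) ≠ 0 → ev i ≤ L) (hC : offMean ev ≤ C) :
    μ {v | offMass u v ≤ s ∧
        ε * offMass u v < |offPrincipal ev u v - offMean ev * offMass u v|}
      ≤ ENNReal.ofReal (s ^ (N - 1) *
          (2 * Real.exp (-(ε ^ 2 * (N - 1 : ℕ) / (4 * (C + ε) * (L + C + ε)))))) := by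
  have hmap := hμ.map_norm_sq_inner hN hu
  obtain ⟨m, rfl⟩ : ∃ m, N = m + 1 := ⟨N - 1, by omega⟩
  let lam := offMean ev
  have hlam0 : 0 ≤ lam := div_nonneg (Finset.sum_nonneg fun i _ => hev i) (Nat.cast_nonneg _)
  have hlam : ∑ i : Fin m, ev i.succ = m * lam := by
    simp only [lam, offMean, sum_filter_ne_zero_eq_sum_succ, Nat.add_sub_cancel]
    -- For `m = 0` the mean is the default value of `0 / 0`, and both sides vanish.
    rcases Nat.eq_zero_or_pos m with rfl | hm
    · simp
    · have : (m : ℝ) ≠ 0 := by positivity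
      field_simp
  let A : Set (Fin (m + 1) → ℝ) := {x | ∑ i : Fin m, x i.succ ≤ s} ∩
    {x | ε * ∑ i : Fin m, x i.succ <
      |∑ i : Fin m, ev i.succ * x i.succ - lam * ∑ i : Fin m, x i.succ|}
  have hA : MeasurableSet A :=
    (measurableSet_le (by fun_prop) (by fun_prop)).inter
      (measurableSet_lt (by fun_prop) (by fun_prop))
  have h1 := congrArg (fun ρ : Measure _ => ρ A) hmap
  rw [Measure.map_apply (by fun_prop) hA, Measure.map_apply (by fun_prop) hA] at h1
  have h2 : {v | offMass u v ≤ s ∧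
        ε * offMass u v < |offPrincipal ev u v - offMean ev * offMass u v|}
      = (fun v i => ‖inner ℂ (u i) v‖ ^ 2) ⁻¹' A := by
    ext v
    simp only [Set.mem_ofPred_eq, Set.mem_preimage, Set.mem_inter_iff, offMass, offPrincipal,
      A, lam,
      sum_filter_ne_zero_eq_sum_succ, one_mul, norm_inner_symm v]
  rw [h2, h1, Nat.add_sub_cancel]
  refine le_trans (le_of_eq ?_) (pi_expMeasure_one_deviation hs hs1 hε (fun i => hev i.succ) hL0
    (fun i => hL i.succ (by simp)) hlam0 hlam hC)
  refine measure_congr ?_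
  filter_upwards [ae_pos_pi_expMeasure_one (m + 1)] with e he
  refine propext ?_
  have hS : 0 < ∑ k, e k := Finset.sum_pos (fun i _ => he i) Finset.univ_nonempty
  change (∑ i : Fin m, e i.succ / ∑ k, e k ≤ s ∧
    ε * ∑ i : Fin m, e i.succ / ∑ k, e k < |∑ i : Fin m, ev i.succ * (e i.succ / ∑ k, e k)
      - lam * ∑ i : Fin m, e i.succ / ∑ k, e k|) ↔ _
  simp_rw [← mul_div_assoc]
  rw [← Finset.sum_div, ← Finset.sum_div, div_le_iff₀ hS, ← mul_div_assoc, ← mul_div_assoc,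
    ← sub_div, abs_div, abs_of_pos hS, div_lt_div_iff_of_pos_right hS]
  rfl

end IsotropicVector

/-! ### Eigenvalues as functions of the matrix and eigenvectors. -/

section SpectralDecomposition

theorem dotProduct_star_eq_ite {N : ℕ} {u : Fin N → CVec N} (hu : Orthonormal ℂ u)
    (k i : Fin N) : star (u k).ofLp ⬝ᵥ (u i).ofLp = if k = i then 1 else 0 := by
  rw [dotProduct_comm, ← EuclideanSpace.inner_eq_star_dotProduct]
  exact orthonormal_iff_ite.1 hu k i

/-- Evaluate `uᴴ S Sᴴ u = ‖Sᴴ u‖²` at an eigenvector. The formula yields nonnegativity, and also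
measurability of the eigenvalues and their independence from the codebook. -/
theorem IsSpectralDecomp.eq_sum_norm_sq {N K : ℕ} {S : Matrix (Fin N) (Fin K) ℂ}
    {ev : Fin N → ℝ} {u : Fin N → CVec N} (h : IsSpectralDecomp (S * S.conjTranspose) ev u)
    (i : Fin N) : ev i = ∑ k, ‖∑ a, star (S a k) * (u i) a‖ ^ 2 := by
  obtain ⟨-, hu, hA⟩ := h
  have h1 : star (u i).ofLp ⬝ᵥ ((S * S.conjTranspose).mulVec (u i).ofLp) = (ev i : ℂ) := by
    rw [hA, Matrix.sum_mulVec, dotProduct_sum]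
    simp_rw [Matrix.smul_mulVec, Matrix.vecMulVec_mulVec, dotProduct_smul]
    simp [dotProduct_star_eq_ite hu]
  have h2 : star (u i).ofLp ⬝ᵥ ((S * S.conjTranspose).mulVec (u i).ofLp)
      = ((∑ k, ‖∑ a, star (S a k) * (u i) a‖ ^ 2 : ℝ) : ℂ) := by
    rw [← Matrix.mulVec_mulVec, Matrix.dotProduct_mulVec]
    have h3 : Matrix.vecMul (star (u i).ofLp) S
        = star (S.conjTranspose.mulVec (u i).ofLp) := by
      rw [Matrix.star_mulVec, Matrix.conjTranspose_conjTranspose]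
    rw [h3]
    push_cast
    refine Finset.sum_congr rfl fun k _ => ?_
    rw [Pi.star_apply, ← Complex.conj_mul']
    rfl
  rw [h1] at h2
  exact_mod_cast h2

theorem IsSpectralDecomp.nonneg {N K : ℕ} {S : Matrix (Fin N) (Fin K) ℂ}
    {ev : Fin N → ℝ} {u : Fin N → CVec N} (h : IsSpectralDecomp (S * S.conjTranspose) ev u)
    (i : Fin N) : 0 ≤ ev i := by
  rw [h.eq_sum_norm_sq i]
  positivity

end SpectralDecomposition

/-! ### Union bounds over the random codebook. -/

section Codebook

variable {N M : ℕ}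

/-- The codebooks with no entry, or an exceptionally good entry, or an atypical good entry. -/
def atypicalCodebooks (sLow sUp ε : ℝ) (ev : Fin N → ℝ) (u : Fin N → CVec N) :
    Set (Fin M → CVec N) :=
  {c | (∀ j, sUp < offMass u (c j)) ∨
    (∃ j, offMass u (c j) ≤ sUp ∧
      ε * offMass u (c j) < |offPrincipal ev u (c j) - offMean ev * offMass u (c j)|) ∨
    ∃ j, offMass u (c j) ≤ sLow}

theorem measurable_offPrincipal {X : Type*} [MeasurableSpace X] {ev : X → Fin N → ℝ}
    {u : X → Fin N → CVec N} {v : X → CVec N} (hev : Measurable ev) (hu : Measurable u)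
    (hv : Measurable v) : Measurable fun x => offPrincipal (ev x) (u x) (v x) := by
  unfold offPrincipal
  fun_prop

theorem measurable_offMass {X : Type*} [MeasurableSpace X]
    {u : X → Fin N → CVec N} {v : X → CVec N} (hu : Measurable u)
    (hv : Measurable v) : Measurable fun x => offMass (u x) (v x) :=
  measurable_offPrincipal measurable_const hu hv

theorem measurable_offMean {X : Type*} [MeasurableSpace X] {ev : X → Fin N → ℝ}
    (hev : Measurable ev) : Measurable fun x => offMean (ev x) := by
  unfold offMean
  fun_prop

/-- Independence gives `(1 - s ^ (N - 1)) ^ M ≤ exp (-M * s ^ (N - 1))`. The alternative `s = 1`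
serves the capped threshold, where the probability is zero because `M > 0`. -/
theorem pi_forall_offMass_lt_le (hN : 0 < N) {μ : Fin M → Measure (CVec N)}
    [∀ j, IsProbabilityMeasure (μ j)] (hμ : ∀ j, IsIsotropicUnit (μ j)) (hM : 0 < M)
    {u : Fin N → CVec N} (hu : Orthonormal ℂ u) {s T : ℝ} (hs : 0 < s) (hs1 : s ≤ 1)
    (hT : s = 1 ∨ T ≤ M * s ^ (N - 1)) :
    Measure.pi μ {c | ∀ j, s < offMass u (c j)} ≤ ENNReal.ofReal (Real.exp (-T)) := by
  have hpow : s ^ (N - 1) ≤ 1 := pow_le_one₀ hs.le hs1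
  have h1 : {c : Fin M → CVec N | ∀ j, s < offMass u (c j)}
      = Set.univ.pi fun _ => {v | offMass u v ≤ s}ᶜ := by
    ext c
    simp [Set.mem_pi]
  have hmeas : MeasurableSet {v | offMass u v ≤ s} :=
    measurableSet_le (measurable_offMass measurable_const measurable_id) measurable_const
  have h2 : ∀ j, μ j {v | offMass u v ≤ s}ᶜ = ENNReal.ofReal (1 - s ^ (N - 1)) := by
    intro j
    rw [prob_compl_eq_one_sub hmeas, (hμ j).measure_offMass_le hN hu hs hs1,
      ENNReal.ofReal_sub _ (by positivity), ENNReal.ofReal_one]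
  rw [h1, Measure.pi_pi]
  simp_rw [h2]
  rw [Finset.prod_const, Finset.card_univ, Fintype.card_fin,
    ← ENNReal.ofReal_pow (by linarith)]
  refine ENNReal.ofReal_le_ofReal ?_
  rcases hT with rfl | hT
  · rw [one_pow, sub_self, zero_pow hM.ne']
    exact (Real.exp_pos _).le
  · calc (1 - s ^ (N - 1)) ^ M ≤ (Real.exp (-(s ^ (N - 1)))) ^ M := by
          refine pow_le_pow_left₀ (by linarith) ?_ _
          linarith [Real.add_one_le_exp (-(s ^ (N - 1)))]
      _ = Real.exp (-(M * s ^ (N - 1))) := by rw [← Real.exp_nat_mul]; ring_nf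
      _ ≤ Real.exp (-T) := Real.exp_le_exp.2 (by linarith)

theorem pi_exists_le_mul {α : Type*} [MeasurableSpace α] {μ : Fin M → Measure α}
    [∀ j, IsProbabilityMeasure (μ j)] {A : Set α} (hA : MeasurableSet A) {p : ℝ}
    (h : ∀ j, μ j A ≤ ENNReal.ofReal p) :
    Measure.pi μ {c | ∃ j, c j ∈ A} ≤ ENNReal.ofReal (M * p) := by
  have h1 : {c : Fin M → α | ∃ j, c j ∈ A} = ⋃ j, Function.eval j ⁻¹' A := by
    ext c; simp
  rw [h1]
  refine (measure_iUnion_fintype_le _ _).trans ?_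
  have h2 : ∀ j, Measure.pi μ (Function.eval j ⁻¹' A) ≤ ENNReal.ofReal p := by
    intro j
    rw [(measurePreserving_eval μ j).measure_preimage hA.nullMeasurableSet]
    exact h j
  refine (Finset.sum_le_sum fun j _ => h2 j).trans ?_
  rw [Finset.sum_const, Finset.card_univ, Fintype.card_fin, ENNReal.ofReal_mul (by positivity),
    ENNReal.ofReal_natCast, nsmul_eq_mul]

/-- In the deviation term the number `M` of entries is absorbed by `sUp ^ (N - 1)`, leaving the
factor `T`; likewise `T'` bounds the expected number of entries below `sLow`. -/
theorem pi_atypicalCodebooks_le (hN : 0 < N) {μ : Fin M → Measure (CVec N)}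
    [∀ j, IsProbabilityMeasure (μ j)] (hμ : ∀ j, IsIsotropicUnit (μ j)) (hM : 0 < M)
    {u : Fin N → CVec N} (hu : Orthonormal ℂ u) {sLow sUp T T' ε C L : ℝ}
    (hs : 0 < sUp) (hs1 : sUp ≤ 1) (hT : sUp = 1 ∨ T ≤ M * sUp ^ (N - 1))
    (hT2 : M * sUp ^ (N - 1) ≤ T) (hl : 0 < sLow) (hl1 : sLow ≤ 1)
    (hT' : M * sLow ^ (N - 1) ≤ T') (hε : 0 < ε) {ev : Fin N → ℝ} (hev : ∀ i, 0 ≤ ev i)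
    (hL0 : 0 ≤ L) (hL : ∀ i : Fin N, (i : ℕ) ≠ 0 → ev i ≤ L) (hC : offMean ev ≤ C) :
    Measure.pi μ (atypicalCodebooks sLow sUp ε ev u) ≤ ENNReal.ofReal (Real.exp (-T)
      + T * (2 * Real.exp (-(ε ^ 2 * (N - 1 : ℕ) / (4 * (C + ε) * (L + C + ε))))) + T') := by
  have hT0 : 0 ≤ T := le_trans (by positivity) hT2
  have hT0' : 0 ≤ T' := le_trans (by positivity) hT'
  have hmass : Measurable fun v => offMass u v :=
    measurable_offMass measurable_const measurable_id
  have hprin : Measurable fun v => offPrincipal ev u v :=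
    measurable_offPrincipal measurable_const measurable_const measurable_id
  rw [ENNReal.ofReal_add (by positivity) hT0', ENNReal.ofReal_add (by positivity) (by positivity),
    add_assoc]
  unfold atypicalCodebooks
  rw [Set.ofPred_or, Set.ofPred_or]
  refine (measure_union_le _ _).trans (add_le_add
    (pi_forall_offMass_lt_le hN hμ hM hu hs hs1 hT)
    ((measure_union_le _ _).trans (add_le_add ?_ ?_)))
  · refine (pi_exists_le_mul (A := {v | offMass u v ≤ sUp ∧
      ε * offMass u v < |offPrincipal ev u v - offMean ev * offMass u v|}) ?_
      fun j => (hμ j).measure_deviation_le hN hu hs hs1 hε hev hL0 hL hC).trans ?_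
    · rw [Set.ofPred_and]
      exact (measurableSet_le hmass measurable_const).inter
        (measurableSet_lt (by fun_prop) (by fun_prop))
    · refine ENNReal.ofReal_le_ofReal ?_
      rw [← mul_assoc]
      exact mul_le_mul_of_nonneg_right hT2 (by positivity)
  · refine (pi_exists_le_mul (A := {v | offMass u v ≤ sLow})
      (measurableSet_le hmass measurable_const)
      fun j => ((hμ j).measure_offMass_le hN hu hl hl1).le).trans ?_
    exact ENNReal.ofReal_le_ofReal hT'

theorem IndepFun.measure_prodMk_mem_le {Ω X Y : Type*} [MeasurableSpace Ω] [MeasurableSpace X]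
    [MeasurableSpace Y] {P : Measure Ω} [IsProbabilityMeasure P] {f : Ω → X} {g : Ω → Y}
    (hf : Measurable f) (hg : Measurable g) (h : IndepFun f g P) {E : Set (X × Y)}
    (hE : MeasurableSet E) {p : ENNReal} (hp : ∀ ω, P.map g (Prod.mk (f ω) ⁻¹' E) ≤ p) :
    P {ω | (f ω, g ω) ∈ E} ≤ p := by
  have : IsProbabilityMeasure (P.map g) := Measure.isProbabilityMeasure_map hg.aemeasurable
  have h1 := (indepFun_iff_map_prod_eq_prod_map_map hf.aemeasurable hg.aemeasurable).1 h
  have h2 : P {ω | (f ω, g ω) ∈ E} = P.map (fun ω => (f ω, g ω)) E :=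
    (Measure.map_apply (hf.prodMk hg) hE).symm
  rw [h2, h1, Measure.prod_apply hE, lintegral_map (measurable_measure_prodMk_left hE) hf]
  calc ∫⁻ ω, P.map g (Prod.mk (f ω) ⁻¹' E) ∂P ≤ ∫⁻ _, p ∂P := lintegral_mono hp
    _ = p := by simp

/-- With high probability the closest codebook entry is at a typical angle from the principal
eigenvector and its off-principal quadratic form is close to its expected value. -/
theorem measure_closest_atypical_le {Ω : Type*} [MeasurableSpace Ω] {P : Measure Ω}
    [IsProbabilityMeasure P] {K : ℕ} (hN : 0 < N) (hM : 0 < M)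
    {S : Ω → Matrix (Fin N) (Fin K) ℂ} {ev : Ω → Fin N → ℝ} {u : Ω → Fin N → CVec N}
    (hS : ∀ i k, Measurable fun ω => S ω i k) (hu : ∀ i, Measurable fun ω => u ω i)
    (hdec : ∀ ω, IsSpectralDecomp (S ω * (S ω).conjTranspose) (ev ω) (u ω))
    {V : Fin M → Ω → CVec N} (hV : IsRVQCodebook P V)
    (hind : IndepFun (fun ω => ((fun i k => S ω i k : Fin N → Fin K → ℂ), u ω))
      (fun ω j => V j ω) P)
    {J : Ω → Fin M} (hJ : ∀ ω, IsClosestInAngle (u ω ⟨0, hN⟩) (fun j => V j ω) (J ω))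
    {sLow sUp T T' ε C L : ℝ}
    (hs : 0 < sUp) (hs1 : sUp ≤ 1) (hT : sUp = 1 ∨ T ≤ M * sUp ^ (N - 1))
    (hT2 : M * sUp ^ (N - 1) ≤ T) (hl : 0 < sLow) (hl1 : sLow ≤ 1)
    (hT' : M * sLow ^ (N - 1) ≤ T') (hε : 0 < ε) (hL0 : 0 ≤ L) :
    P {ω | (∀ i : Fin N, (i : ℕ) ≠ 0 → ev ω i ≤ L) ∧ offMean (ev ω) ≤ C ∧
        ¬ ∃ r : ℝ, sLow ≤ r ∧ r ≤ sUp ∧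
          |offPrincipal (ev ω) (u ω) (V (J ω) ω) - offMean (ev ω) * r| ≤ ε}
      ≤ ENNReal.ofReal (Real.exp (-T)
        + T * (2 * Real.exp (-(ε ^ 2 * (N - 1 : ℕ) / (4 * (C + ε) * (L + C + ε))))) + T') := by
  obtain ⟨hVm, hVi, hViso⟩ := hV
  have hprob : ∀ j, IsProbabilityMeasure (P.map (V j)) := fun j =>
    Measure.isProbabilityMeasure_map (hVm j).aemeasurable
  have hnorm : ∀ᵐ ω ∂P, ∀ j, ‖V j ω‖ = 1 := by
    rw [ae_all_iff]
    exact fun j => ae_of_ae_map (hVm j).aemeasurable (hViso j).1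
  have hWm : Measurable fun ω j => V j ω := measurable_pi_lambda _ hVm
  -- `F` rebuilds the eigenvalues measurably from the matrix and eigenvectors, so independence
  -- passes to the pair of eigenvalues and eigenvectors.
  let F : (Fin N → Fin K → ℂ) × (Fin N → CVec N) → (Fin N → ℝ) × (Fin N → CVec N) :=
    fun x => (fun i => ∑ k, ‖∑ a, star (x.1 a k) * (x.2 i) a‖ ^ 2, x.2)
  have hF : Measurable F := by
    refine Measurable.prodMk ?_ measurable_snd
    refine measurable_pi_lambda _ fun i => ?_
    have : Continuous fun x : (Fin N → Fin K → ℂ) × (Fin N → CVec N) =>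
        ∑ k, ‖∑ a, star (x.1 a k) * (x.2 i) a‖ ^ 2 := by fun_prop
    exact this.measurable
  have hFe : ∀ ω, F ((fun i k => S ω i k), u ω) = (ev ω, u ω) := by
    intro ω
    refine Prod.ext (funext fun i => ?_) rfl
    exact ((hdec ω).eq_sum_norm_sq i).symm
  have hXm : Measurable fun ω => (ev ω, u ω) := by
    have : Measurable fun ω => F ((fun i k => S ω i k), u ω) :=
      hF.comp (Measurable.prodMk (measurable_pi_lambda _ fun i => measurable_pi_lambda _ fun k =>
        hS i k) (measurable_pi_lambda _ hu))
    simpa only [hFe] using this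
  have hind' : IndepFun (fun ω => (ev ω, u ω)) (fun ω j => V j ω) P := by
    have := hind.comp hF measurable_id
    have h2 : F ∘ (fun ω => ((fun i k => S ω i k : Fin N → Fin K → ℂ), u ω))
        = fun ω => (ev ω, u ω) := funext hFe
    rwa [h2] at this
  let E : Set (((Fin N → ℝ) × (Fin N → CVec N)) × (Fin M → CVec N)) :=
    {p | (∀ i : Fin N, (i : ℕ) ≠ 0 → p.1.1 i ≤ L) ∧ offMean p.1.1 ≤ C ∧
      p.2 ∈ atypicalCodebooks sLow sUp ε p.1.1 p.1.2}
  have hmass : ∀ j, Measurable fun p : ((Fin N → ℝ) × (Fin N → CVec N)) × (Fin M → CVec N) =>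
      offMass p.1.2 (p.2 j) := fun j => measurable_offMass (by fun_prop) (by fun_prop)
  have hprin : ∀ j, Measurable fun p : ((Fin N → ℝ) × (Fin N → CVec N)) × (Fin M → CVec N) =>
      offPrincipal p.1.1 p.1.2 (p.2 j) := fun j =>
    measurable_offPrincipal (by fun_prop) (by fun_prop) (by fun_prop)
  have hmean : Measurable fun p : ((Fin N → ℝ) × (Fin N → CVec N)) × (Fin M → CVec N) =>
      offMean p.1.1 := measurable_offMean (by fun_prop)
  have hE : MeasurableSet E := by
    refine measurableSet_setOfPred.2 (Measurable.and ?_ (Measurable.and ?_ (Measurable.or ?_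
      (Measurable.or ?_ ?_))))
    · exact Measurable.forall fun i => Measurable.imp measurable_const
        (measurableSet_setOfPred.1 (measurableSet_le (by fun_prop) measurable_const))
    · exact measurableSet_setOfPred.1 (measurableSet_le hmean measurable_const)
    · exact Measurable.forall fun j => measurableSet_setOfPred.1
        (measurableSet_lt measurable_const (hmass j))
    · refine Measurable.exists fun j => Measurable.and
        (measurableSet_setOfPred.1 (measurableSet_le (hmass j) measurable_const))
        (measurableSet_setOfPred.1 (measurableSet_lt ((hmass j).const_mul ε) ?_))
      exact ((hprin j).sub (hmean.mul (hmass j))).abs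
    · exact Measurable.exists fun j => measurableSet_setOfPred.1
        (measurableSet_le (hmass j) measurable_const)
  refine le_trans (measure_mono_ae ?_) (IndepFun.measure_prodMk_mem_le hXm hWm hind' hE ?_)
  · filter_upwards [hnorm] with ω hω
    rintro ⟨h1, h2, h3⟩
    refine ⟨h1, h2, ?_⟩
    by_contra h4
    apply h3
    simp only [atypicalCodebooks, Set.mem_ofPred_eq, not_or, not_exists, not_forall, not_and,
      not_lt, not_le] at h4
    obtain ⟨⟨j, hj⟩, h5, h6⟩ := h4
    -- The selected entry has the least off-principal mass, and some entry `j` already lies below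
    -- `sUp`.
    have hle : offMass (u ω) (V (J ω) ω) ≤ sUp := by
      refine le_trans ?_ hj
      rw [offMass_eq hN (hdec ω).2.1, offMass_eq hN (hdec ω).2.1, hω, hω]
      linarith [hJ ω j]
    refine ⟨offMass (u ω) (V (J ω) ω), (h6 _).le, hle, (h5 _ hle).trans ?_⟩
    exact mul_le_of_le_one_right hε.le (hle.trans hs1)
  · intro ω
    have hmap : P.map (fun ω j => V j ω) = Measure.pi fun j => P.map (V j) :=
      (iIndepFun_iff_map_fun_eq_pi_map fun j => (hVm j).aemeasurable).1 hVi
    rw [hmap]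
    by_cases h : (∀ i : Fin N, (i : ℕ) ≠ 0 → ev ω i ≤ L) ∧ offMean (ev ω) ≤ C
    · refine (measure_mono fun c hc => ?_).trans (pi_atypicalCodebooks_le hN hViso hM
        (hdec ω).2.1 hs hs1 hT hT2 hl hl1 hT' hε (fun i => (hdec ω).nonneg i) hL0 h.1 h.2)
      exact hc.2.2
    -- The spectral constraints are part of `E`, so spectra violating them contribute nothing and
    -- the section bound is uniform.
    · have : Prod.mk (ev ω, u ω) ⁻¹' E = ∅ := by
        ext c
        simp only [Set.mem_preimage, Set.mem_empty_iff_false, iff_false]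
        exact fun hc => h ⟨hc.1, hc.2.1⟩
      rw [this, measure_empty]
      exact zero_le

end Codebook

/-! ### Deterministic estimates for truncated spectral means. -/

section SpectralLimit

/-- The positive part, truncated at `R`. -/
noncomputable def posTrunc (R : ℝ) : ℝ →ᵇ ℝ :=
  BoundedContinuousFunction.ofNormedAddCommGroup (fun x => min (max x 0) |R|) (by fun_prop) |R|
    (fun x => by
      rw [Real.norm_eq_abs, abs_of_nonneg (le_min (le_max_right _ _) (abs_nonneg R))]
      exact min_le_right _ _)

theorem posTrunc_apply {R : ℝ} (hR : 0 ≤ R) (x : ℝ) :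
    posTrunc R x = min (max x 0) R := by
  simp [posTrunc, abs_of_nonneg hR]

variable {N : ℕ} {ev : Fin N → ℝ}

/-- The normalized sum of the non-principal eigenvalues. -/
noncomputable def offAverage (ev : Fin N → ℝ) : ℝ :=
  (∑ i ∈ Finset.univ.filter (fun i : Fin N => (i : ℕ) ≠ 0), ev i) / N

theorem spectralTail_antitone (hev : ∀ i, 0 ≤ ev i) {R R' : ℝ} (h : R ≤ R') :
    spectralTail ev R' ≤ spectralTail ev R := by
  refine div_le_div_of_nonneg_right ?_ (Nat.cast_nonneg N)
  refine Finset.sum_le_sum_of_subset_of_nonneg (fun i => ?_) fun i _ _ => hev i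
  simp only [Finset.mem_filter, Finset.mem_univ, true_and]
  exact fun hi => ⟨hi.1, h.trans_lt hi.2⟩

theorem offAverage_le (hev : ∀ i, 0 ≤ ev i) {R : ℝ} (hR : 0 ≤ R) :
    offAverage ev ≤ spectralMean ev (posTrunc R) + spectralTail ev R := by
  unfold offAverage spectralMean spectralTail
  rw [← add_div]
  refine div_le_div_of_nonneg_right ?_ (Nat.cast_nonneg N)
  rw [Finset.sum_filter, Finset.sum_filter, ← Finset.sum_add_distrib]
  refine Finset.sum_le_sum fun i _ => ?_
  rw [posTrunc_apply hR, max_eq_left (hev i)]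
  have h0 := hev i
  have h1 : 0 ≤ min (ev i) R := le_min h0 hR
  by_cases hi : (i : ℕ) = 0
  · simp [hi, h1]
  · by_cases hR' : R < ev i
    · simp only [hi, hR', not_false_eq_true, if_true, and_self, ne_eq]
      linarith
    · simp [hi, hR', min_eq_left (not_lt.1 hR')]

/-- The term `R / N` pays for the principal eigenvalue, which may be arbitrarily large but is
truncated at `R`. -/
theorem spectralMean_truncation_le (hev : ∀ i, 0 ≤ ev i) {R : ℝ} (hR : 0 ≤ R) :
    spectralMean ev (posTrunc R) ≤ offAverage ev + R / N := by
  unfold offAverage spectralMean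
  rw [← add_div]
  refine div_le_div_of_nonneg_right ?_ (Nat.cast_nonneg N)
  rcases Nat.eq_zero_or_pos N with rfl | hN
  · simpa using hR
  obtain ⟨m, rfl⟩ : ∃ m, N = m + 1 := ⟨N - 1, by omega⟩
  rw [sum_filter_ne_zero_eq_sum_succ, Fin.sum_univ_succ, add_comm]
  simp_rw [posTrunc_apply hR]
  refine add_le_add (Finset.sum_le_sum fun i _ => ?_) (min_le_right _ _)
  rw [max_eq_left (hev _)]
  exact min_le_left _ _

theorem spectralMean_truncation_le_self {R : ℝ} (hR : 0 ≤ R) :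
    spectralMean ev (posTrunc R) ≤ R := by
  unfold spectralMean
  rcases Nat.eq_zero_or_pos N with rfl | hN
  · simpa using hR
  rw [div_le_iff₀ (by exact_mod_cast hN)]
  calc ∑ i, posTrunc R (ev i) ≤ ∑ _i : Fin N, R := Finset.sum_le_sum fun i _ => by
        rw [posTrunc_apply hR]; exact min_le_right _ _
    _ = R * N := by simp [mul_comm]

/-- A single eigenvalue above `R` is at most the whole tail sum. Uniform integrability thus forces
the second eigenvalue to be `o(N)`. -/
theorem le_max_of_spectralTail_le (hev : ∀ i, 0 ≤ ev i) (hN : 0 < N) {R ε : ℝ}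
    (h : spectralTail ev R ≤ ε) {i : Fin N} (hi : (i : ℕ) ≠ 0) : ev i ≤ max R (ε * N) := by
  by_cases hR : R < ev i
  · refine le_max_of_le_right ?_
    rw [spectralTail, div_le_iff₀ (by exact_mod_cast hN)] at h
    refine le_trans ?_ h
    exact Finset.single_le_sum (f := ev) (fun j _ => hev j) (by simp [hi, hR])
  · exact le_max_of_le_left (not_lt.1 hR)

theorem offMean_eq (hN : 2 ≤ N) : offMean ev = offAverage ev * (N / ((N - 1 : ℕ) : ℝ)) := by
  unfold offMean offAverage
  have h1 : (N : ℝ) ≠ 0 := by positivity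
  field_simp

/-- A quantitative form of the convergence of the mean of the non-principal eigenvalues. -/
theorem abs_offMean_sub_le (hev : ∀ i, 0 ≤ ev i) (hN : 2 ≤ N) {R ε a I : ℝ} (hR : 0 ≤ R)
    (h1 : |spectralMean ev (posTrunc R) - a| ≤ ε) (h2 : |a - I| ≤ ε)
    (h3 : spectralTail ev R ≤ ε) (hRN : R ≤ ε * N) (hIN : I + 3 * ε ≤ ε * ((N - 1 : ℕ) : ℝ)) :
    |offMean ev - I| ≤ 4 * ε := by
  have hN0 : (0 : ℝ) < N := by positivity
  have hN1 : (0 : ℝ) < ((N - 1 : ℕ) : ℝ) := by exact_mod_cast (by omega : 0 < N - 1)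
  have hcast : ((N - 1 : ℕ) : ℝ) = N - 1 := by
    rw [Nat.cast_sub (by omega)]; simp
  have h4 := offAverage_le hev hR
  have h5 := spectralMean_truncation_le hev hR
  have h6 : R / N ≤ ε := (div_le_iff₀ hN0).2 hRN
  obtain ⟨h1a, h1b⟩ := abs_le.1 h1
  obtain ⟨h2a, h2b⟩ := abs_le.1 h2
  have h0 : 0 ≤ offAverage ev := div_nonneg (Finset.sum_nonneg fun i _ => hev i) hN0.le
  -- Changing the normalization from `N` to `N - 1` costs one `ε`; the truncated mean, its limit,
  -- and the tail or `R / N` account for the other three.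
  have h7 : offMean ev = offAverage ev + offAverage ev / ((N - 1 : ℕ) : ℝ) := by
    rw [offMean_eq hN, hcast]
    rw [hcast] at hN1
    field_simp
    ring
  have h8 : offAverage ev / ((N - 1 : ℕ) : ℝ) ≤ ε := by
    rw [div_le_iff₀ hN1]
    linarith
  have h9 : 0 ≤ offAverage ev / ((N - 1 : ℕ) : ℝ) := div_nonneg h0 hN1.le
  rw [h7, abs_le]
  constructor <;> linarith

/-- Monotone convergence turns the uniform bound into integrability of the positive part, which then
dominates the truncations. -/
theorem integrableOn_and_tendsto_of_integral_truncation_le {ν : Measure ℝ}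
    [IsProbabilityMeasure ν] {b : ℝ} (hb : ∀ k : ℕ, ∫ x, posTrunc k x ∂ν ≤ b) :
    IntegrableOn (fun x : ℝ => x) (Set.Ici 0) ν ∧
      Tendsto (fun k : ℕ => ∫ x, posTrunc k x ∂ν) atTop (𝓝 (∫ x in Set.Ici 0, x ∂ν)) := by
  have hind : (fun x : ℝ => max x 0) = (Set.Ici 0).indicator fun x => x := by
    funext x
    by_cases hx : 0 ≤ x
    · rw [Set.indicator_of_mem (Set.mem_Ici.2 hx), max_eq_left hx]
    · rw [Set.indicator_of_notMem (by simpa using hx), max_eq_right (not_le.1 hx).le]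
  have hlim : ∀ x : ℝ, Tendsto (fun k : ℕ => posTrunc k x) atTop (𝓝 (max x 0)) := by
    intro x
    refine tendsto_const_nhds.congr' ?_
    filter_upwards [tendsto_natCast_atTop_atTop.eventually_ge_atTop (max x 0)] with k hk
    rw [posTrunc_apply (Nat.cast_nonneg k), min_eq_left hk]
  have hnn : ∀ (k : ℕ) (x : ℝ), 0 ≤ posTrunc k x := by
    intro k x
    rw [posTrunc_apply (Nat.cast_nonneg k)]
    exact le_min (le_max_right _ _) (Nat.cast_nonneg k)
  have hint : Integrable (fun x : ℝ => max x 0) ν := by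
    refine ⟨by fun_prop, ?_⟩
    rw [hasFiniteIntegral_iff_ofReal (f := fun x : ℝ => max x 0)
      (Filter.Eventually.of_forall fun x => le_max_right x 0)]
    have h1 : Tendsto (fun k : ℕ => ∫⁻ x, ENNReal.ofReal (posTrunc k x) ∂ν) atTop
        (𝓝 (∫⁻ x, ENNReal.ofReal (max x 0) ∂ν)) := by
      refine lintegral_tendsto_of_tendsto_of_monotone (fun k => ?_) ?_ ?_
      · exact ((posTrunc k).continuous.measurable.ennreal_ofReal).aemeasurable
      · refine Filter.Eventually.of_forall fun x k l hkl => ENNReal.ofReal_le_ofReal ?_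
        rw [posTrunc_apply (Nat.cast_nonneg k), posTrunc_apply (Nat.cast_nonneg l)]
        exact min_le_min_left _ (by exact_mod_cast hkl)
      · exact Filter.Eventually.of_forall fun x => ENNReal.tendsto_ofReal (hlim x)
    refine lt_of_le_of_lt (le_of_tendsto' h1 fun k => ?_) (ENNReal.ofReal_lt_top (r := b))
    rw [← ofReal_integral_eq_lintegral_ofReal ((posTrunc k).integrable ν)
      (Filter.Eventually.of_forall (hnn k))]
    exact ENNReal.ofReal_le_ofReal (hb k)
  constructor
  · rw [hind] at hint
    exact (integrable_indicator_iff measurableSet_Ici).1 hint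
  · rw [← integral_indicator measurableSet_Ici, ← hind]
    refine tendsto_integral_of_dominated_convergence (fun x => max x 0)
      (fun k => (posTrunc k).continuous.aestronglyMeasurable) hint (fun k => ?_)
      (Filter.Eventually.of_forall hlim)
    refine Filter.Eventually.of_forall fun x => ?_
    rw [Real.norm_eq_abs, abs_of_nonneg (hnn k x), posTrunc_apply (Nat.cast_nonneg k)]
    exact min_le_left _ _

/-- The bound does not involve `R`: the truncation at `R` is compared with the fixed cutoff `max R'
0`, where the maximum guards against a negative `R'`. -/
theorem integral_truncation_le {a R R' : ℝ} (hev : ∀ i, 0 ≤ ev i) (hR : 0 ≤ R) (hN : R ≤ N)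
    (hN0 : 0 < N) (h1 : |spectralMean ev (posTrunc R) - a| ≤ 1) (h2 : spectralTail ev R' ≤ 1) :
    a ≤ max R' 0 + 3 := by
  have h3 := spectralMean_truncation_le hev hR
  have h4 := offAverage_le hev (le_max_right R' 0)
  have h5 := spectralMean_truncation_le_self (ev := ev) (le_max_right R' 0)
  have h6 := spectralTail_antitone hev (le_max_left R' 0)
  have h7 : R / N ≤ 1 := (div_le_one (by exact_mod_cast hN0)).2 hN
  linarith [(abs_le.1 h1).1]

end SpectralLimit

/-! ### Convergence of the mean non-principal eigenvalue. -/

section RandomSpectrum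

variable {Ω : Type*} [MeasurableSpace Ω] {P : Measure Ω} {N : ℕ → ℕ}
  {ev : (n : ℕ) → Ω → Fin (N n) → ℝ} {ν : Measure ℝ} [IsProbabilityMeasure ν]

theorem eventually_measure_le_of_tendstoInMeasure {f : ℕ → Ω → ℝ} {a : ℝ}
    (h : TendstoInMeasure P f atTop fun _ => a) {ε δ : ℝ} (hε : 0 < ε) (hδ : 0 < δ) :
    ∀ᶠ n in atTop, P {ω | ε ≤ |f n ω - a|} ≤ ENNReal.ofReal δ := by
  rw [tendstoInMeasure_iff_norm] at h
  exact (h ε hε).eventually_le_const (ENNReal.ofReal_pos.2 hδ)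

theorem SpectrumTendstoInProb.integrableOn_and_tendsto [IsProbabilityMeasure P]
    (hN : Tendsto N atTop atTop)
    (hev : ∀ n ω i, 0 ≤ ev n ω i) (h : SpectrumTendstoInProb P ev ν)
    (hui : SpectrumUIInProb P ev) :
    IntegrableOn (fun x : ℝ => x) (Set.Ici 0) ν ∧
      Tendsto (fun k : ℕ => ∫ x, posTrunc k x ∂ν) atTop (𝓝 (∫ x in Set.Ici 0, x ∂ν)) := by
  obtain ⟨R', hR'⟩ := hui 1 one_pos (1 / 3) (by norm_num)
  refine integrableOn_and_tendsto_of_integral_truncation_le (b := max R' 0 + 3) fun k => ?_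
  have h1 := eventually_measure_le_of_tendstoInMeasure (h (posTrunc k)) one_pos
    (show (0 : ℝ) < 1 / 3 by norm_num)
  obtain ⟨n, hn1, hn2, hn3⟩ := (hR'.and (h1.and (hN.eventually_ge_atTop (k + 1)))).exists
  -- Two events of probability at most `1 / 3` cannot cover the space. One good outcome suffices,
  -- since the integral to be bounded is deterministic.
  have h2 : P ({ω | 1 ≤ spectralTail (ev n ω) R'} ∪
      {ω | 1 ≤ |spectralMean (ev n ω) (posTrunc k) - ∫ x, posTrunc k x ∂ν|}) < 1 := by
    refine ((measure_union_le _ _).trans (add_le_add hn1 hn2)).trans_lt ?_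
    rw [← ENNReal.ofReal_add (by norm_num) (by norm_num), ← ENNReal.ofReal_one]
    exact (ENNReal.ofReal_lt_ofReal_iff one_pos).2 (by norm_num)
  obtain ⟨ω, hω⟩ : ∃ ω, ω ∉ ({ω | 1 ≤ spectralTail (ev n ω) R'} ∪
      {ω | 1 ≤ |spectralMean (ev n ω) (posTrunc k) - ∫ x, posTrunc k x ∂ν|}) := by
    by_contra hcon
    push Not at hcon
    rw [Set.eq_univ_of_forall hcon, measure_univ] at h2
    exact lt_irrefl _ h2
  simp only [Set.mem_union, Set.mem_ofPred_eq, not_or, not_le] at hω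
  exact integral_truncation_le (hev n ω) (Nat.cast_nonneg k)
    (by exact_mod_cast (Nat.le_succ k).trans hn3) (by omega) hω.2.le hω.1.le

theorem SpectrumTendstoInProb.offMean_near [IsProbabilityMeasure P]
    (hN : Tendsto N atTop atTop)
    (hev : ∀ n ω i, 0 ≤ ev n ω i) (h : SpectrumTendstoInProb P ev ν)
    (hui : SpectrumUIInProb P ev) {ε δ : ℝ} (hε : 0 < ε) (hδ : 0 < δ) :
    ∀ᶠ n in atTop, P {ω | ε < |offMean (ev n ω) - ∫ x in Set.Ici 0, x ∂ν|}
      ≤ ENNReal.ofReal δ := by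
  have hlim := (h.integrableOn_and_tendsto hN hev hui).2
  set I := ∫ x in Set.Ici 0, x ∂ν
  have hε4 : 0 < ε / 4 := by positivity
  obtain ⟨R, hR⟩ := hui (ε / 4) hε4 (δ / 2) (by positivity)
  have hk1 := hlim.eventually (Metric.closedBall_mem_nhds I hε4)
  obtain ⟨k, hk1, hk2⟩ := (hk1.and
    (tendsto_natCast_atTop_atTop.eventually_ge_atTop R)).exists
  have h1 := eventually_measure_le_of_tendstoInMeasure (h (posTrunc k)) hε4
    (show 0 < δ / 2 by positivity)
  have hNr : Tendsto (fun n => (N n : ℝ)) atTop atTop := tendsto_natCast_atTop_atTop.comp hN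
  filter_upwards [hR, h1, hN.eventually_ge_atTop 2,
    hNr.eventually_ge_atTop ((k : ℝ) / (ε / 4)),
    hNr.eventually_ge_atTop ((I + 3 * (ε / 4)) / (ε / 4) + 1)] with n hn1 hn2 hn3 hn4 hn5
  have hsub : {ω | ε < |offMean (ev n ω) - I|} ⊆ {ω | ε / 4 ≤ spectralTail (ev n ω) R} ∪
      {ω | ε / 4 ≤ |spectralMean (ev n ω) (posTrunc k) - ∫ x, posTrunc k x ∂ν|} := by
    intro ω hω
    by_contra hcon
    simp only [Set.mem_union, Set.mem_ofPred_eq, not_or, not_le] at hcon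
    have hlt : ε < |offMean (ev n ω) - I| := hω
    refine absurd hlt (not_lt.2 ?_)
    rw [show ε = 4 * (ε / 4) by ring]
    refine abs_offMean_sub_le (hev n ω) hn3 (Nat.cast_nonneg k) hcon.2.le
      (by simpa [Real.dist_eq] using hk1)
      ((spectralTail_antitone (hev n ω) hk2).trans hcon.1.le) ?_ ?_
    · rw [div_le_iff₀ hε4] at hn4
      linarith
    · rw [Nat.cast_sub (by omega), Nat.cast_one]
      rw [← le_sub_iff_add_le, div_le_iff₀ hε4] at hn5
      linarith
  refine (measure_mono hsub).trans ((measure_union_le _ _).trans ((add_le_add hn1 hn2).trans ?_))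
  rw [← ENNReal.ofReal_add (by positivity) (by positivity), add_halves]

theorem SpectrumUIInProb.le_mul (hN : Tendsto N atTop atTop)
    (hev : ∀ n ω i, 0 ≤ ev n ω i) (hui : SpectrumUIInProb P ev) {ε δ : ℝ} (hε : 0 < ε)
    (hδ : 0 < δ) :
    ∀ᶠ n in atTop, P {ω | ¬ ∀ i : Fin (N n), (i : ℕ) ≠ 0 → ev n ω i ≤ ε * N n}
      ≤ ENNReal.ofReal δ := by
  obtain ⟨R, hR⟩ := hui ε hε δ hδ
  have hNr : Tendsto (fun n => (N n : ℝ)) atTop atTop := tendsto_natCast_atTop_atTop.comp hN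
  filter_upwards [hR, hN.eventually_gt_atTop 0, hNr.eventually_ge_atTop (R / ε)]
    with n hn1 hn2 hn3
  refine (measure_mono fun ω hω => ?_).trans hn1
  by_contra hcon
  refine hω fun i hi => (le_max_of_spectralTail_le (hev n ω) hn2 (not_le.1 hcon).le hi).trans ?_
  rw [div_le_iff₀ hε] at hn3
  exact max_le (by linarith) le_rfl

theorem SpectrumTendstoAS.integrableOn_and_tendsto [IsProbabilityMeasure P]
    (hN : Tendsto N atTop atTop)
    (hev : ∀ n ω i, 0 ≤ ev n ω i) (h : SpectrumTendstoAS P ev ν)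
    (hui : SpectrumUIAS P ev) :
    IntegrableOn (fun x : ℝ => x) (Set.Ici 0) ν ∧
      Tendsto (fun k : ℕ => ∫ x, posTrunc k x ∂ν) atTop (𝓝 (∫ x in Set.Ici 0, x ∂ν)) := by
  obtain ⟨ω, h1, h2⟩ := (h.and hui).exists
  obtain ⟨R', hR'⟩ := h2 1 one_pos
  refine integrableOn_and_tendsto_of_integral_truncation_le (b := max R' 0 + 3) fun k => ?_
  obtain ⟨n, hn1, hn2, hn3⟩ := (hR'.and (((h1 (posTrunc k)).eventually
    (Metric.closedBall_mem_nhds _ one_pos)).and (hN.eventually_ge_atTop (k + 1)))).exists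
  exact integral_truncation_le (hev n ω) (Nat.cast_nonneg k)
    (by exact_mod_cast (Nat.le_succ k).trans hn3) (by omega)
    (by simpa [Real.dist_eq] using hn2) hn1

theorem SpectrumTendstoAS.offMean_near [IsProbabilityMeasure P]
    (hN : Tendsto N atTop atTop)
    (hev : ∀ n ω i, 0 ≤ ev n ω i) (h : SpectrumTendstoAS P ev ν)
    (hui : SpectrumUIAS P ev) :
    ∀ᵐ ω ∂P, ∀ ε > (0 : ℝ), ∀ᶠ n in atTop,
      |offMean (ev n ω) - ∫ x in Set.Ici 0, x ∂ν| ≤ ε := by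
  have hlim := (h.integrableOn_and_tendsto hN hev hui).2
  set I := ∫ x in Set.Ici 0, x ∂ν
  filter_upwards [h, hui] with ω h1 h2 ε hε
  have hε4 : 0 < ε / 4 := by positivity
  obtain ⟨R, hR⟩ := h2 (ε / 4) hε4
  have hk1 := hlim.eventually (Metric.closedBall_mem_nhds I hε4)
  obtain ⟨k, hk1, hk2⟩ := (hk1.and
    (tendsto_natCast_atTop_atTop.eventually_ge_atTop R)).exists
  have hNr : Tendsto (fun n => (N n : ℝ)) atTop atTop := tendsto_natCast_atTop_atTop.comp hN
  filter_upwards [hR, (h1 (posTrunc k)).eventually (Metric.closedBall_mem_nhds _ hε4),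
    hN.eventually_ge_atTop 2, hNr.eventually_ge_atTop ((k : ℝ) / (ε / 4)),
    hNr.eventually_ge_atTop ((I + 3 * (ε / 4)) / (ε / 4) + 1)] with n hn1 hn2 hn3 hn4 hn5
  rw [show ε = 4 * (ε / 4) by ring]
  refine abs_offMean_sub_le (hev n ω) hn3 (Nat.cast_nonneg k)
    (by simpa [Real.dist_eq] using hn2) (by simpa [Real.dist_eq] using hk1)
    ((spectralTail_antitone (hev n ω) hk2).trans hn1) ?_ ?_
  · rw [div_le_iff₀ hε4] at hn4
    linarith
  · rw [Nat.cast_sub (by omega), Nat.cast_one]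
    rw [← le_sub_iff_add_le, div_le_iff₀ hε4] at hn5
    linarith

end RandomSpectrum

/-! ### The typical off-principal mass of the best entry. -/

section Threshold

/-- The fraction `s` of off-principal mass at which a codebook of `2 ^ B` isotropic vectors is
expected to have `T` entries of smaller off-principal mass. -/
noncomputable def massThreshold (T : ℝ) (B N : ℕ) : ℝ :=
  min 1 ((T / 2 ^ B) ^ (((N - 1 : ℕ) : ℝ)⁻¹))

variable {T : ℝ} {B N : ℕ}

theorem massThreshold_pos (hT : 0 < T) : 0 < massThreshold T B N :=
  lt_min one_pos (Real.rpow_pos_of_pos (by positivity) _)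

theorem massThreshold_le_one : massThreshold T B N ≤ 1 := min_le_left _ _

theorem two_pow_mul_rpow_inv_pow (hT : 0 < T) (hN : 2 ≤ N) :
    ((2 ^ B : ℕ) : ℝ) * ((T / 2 ^ B) ^ (((N - 1 : ℕ) : ℝ)⁻¹)) ^ (N - 1) = T := by
  rw [Real.rpow_inv_natCast_pow (by positivity) (by omega)]
  push_cast
  field_simp

theorem two_pow_mul_massThreshold_pow_le (hT : 0 < T) (hN : 2 ≤ N) :
    ((2 ^ B : ℕ) : ℝ) * massThreshold T B N ^ (N - 1) ≤ T := by
  conv_rhs => rw [← two_pow_mul_rpow_inv_pow (B := B) hT hN]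
  gcongr
  · exact (massThreshold_pos hT).le
  · exact min_le_right _ _

theorem massThreshold_eq_one_or (hT : 0 < T) (hN : 2 ≤ N) :
    massThreshold T B N = 1 ∨ T ≤ ((2 ^ B : ℕ) : ℝ) * massThreshold T B N ^ (N - 1) := by
  rcases le_total 1 ((T / 2 ^ B) ^ (((N - 1 : ℕ) : ℝ)⁻¹)) with h | h
  · exact Or.inl (min_eq_left h)
  · right
    rw [massThreshold, min_eq_right h, two_pow_mul_rpow_inv_pow hT hN]

/-- The logarithm of the root is `(log T / N - (B / N) log 2) * (N / (N - 1))`, so a subexponential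
`T` does not affect the limit. The cap at 1 is harmless because `b ≥ 0`. -/
theorem tendsto_massThreshold {N B : ℕ → ℕ} {T : ℕ → ℝ} {b : ℝ} (hN : Tendsto N atTop atTop)
    (hB : Tendsto (fun n => (B n : ℝ) / N n) atTop (𝓝 b)) (hT : ∀ᶠ n in atTop, 0 < T n)
    (hlog : Tendsto (fun n => Real.log (T n) / N n) atTop (𝓝 0)) :
    Tendsto (fun n => massThreshold (T n) (B n) (N n)) atTop (𝓝 ((2 : ℝ) ^ (-b))) := by
  have hb : 0 ≤ b := ge_of_tendsto' hB fun n => by positivity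
  have hNr : Tendsto (fun n => (N n : ℝ)) atTop atTop := tendsto_natCast_atTop_atTop.comp hN
  have hratio : Tendsto (fun n => (N n : ℝ) / ((N n - 1 : ℕ) : ℝ)) atTop (𝓝 1) := by
    have h1 : Tendsto (fun n => (1 - (N n : ℝ)⁻¹)⁻¹) atTop (𝓝 (1 - 0)⁻¹) :=
      (tendsto_const_nhds.sub (tendsto_inv_atTop_zero.comp hNr)).inv₀ (by norm_num)
    rw [sub_zero, inv_one] at h1
    refine h1.congr' ?_
    filter_upwards [hN.eventually_ge_atTop 2] with n hn
    have h2 : (2 : ℝ) ≤ N n := by exact_mod_cast hn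
    rw [Nat.cast_sub (by omega), Nat.cast_one]
    field_simp
  have hexp : Tendsto (fun n => Real.exp ((Real.log (T n) / N n - B n / N n * Real.log 2)
      * (N n / ((N n - 1 : ℕ) : ℝ)))) atTop (𝓝 (Real.exp ((0 - b * Real.log 2) * 1))) :=
    (Real.continuous_exp.tendsto _).comp ((hlog.sub (hB.mul_const _)).mul hratio)
  have hval : Real.exp ((0 - b * Real.log 2) * 1) = (2 : ℝ) ^ (-b) := by
    rw [Real.rpow_def_of_pos (by norm_num)]
    congr 1
    ring
  rw [hval] at hexp
  have hle : (2 : ℝ) ^ (-b) ≤ 1 := Real.rpow_le_one_of_one_le_of_nonpos (by norm_num) (by linarith)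
  rw [← min_eq_right hle]
  refine (tendsto_const_nhds.min hexp).congr' ?_
  filter_upwards [hN.eventually_ge_atTop 2, hT] with n hn hTn
  have h2 : (2 : ℝ) ≤ N n := by exact_mod_cast hn
  have h3 : (N n : ℝ) - 1 ≠ 0 := by linarith
  unfold massThreshold
  congr 1
  rw [Real.rpow_def_of_pos (by positivity), Real.log_div hTn.ne' (by positivity), Real.log_pow,
    Nat.cast_sub (by omega), Nat.cast_one]
  congr 1
  field_simp

end Threshold

/-! ### Combining the mass and mean approximations. -/

theorem abs_sub_mul_le_of_near {Q lam r s I ε : ℝ} (hr : |r - s| ≤ ε) (hr0 : 0 ≤ r) (hr1 : r ≤ 1)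
    (hI : 0 ≤ I) (hlam : |lam - I| ≤ ε) (hQ : |Q - lam * r| ≤ ε) :
    |Q - s * I| ≤ ε * (2 + I) := by
  have h1 : Q - s * I = (Q - lam * r) + (lam - I) * r + (r - s) * I := by ring
  have h2 : |(lam - I) * r| ≤ ε := by
    rw [abs_mul, abs_of_nonneg hr0]
    exact (mul_le_of_le_one_right (abs_nonneg _) hr1).trans hlam
  have h3 : |(r - s) * I| ≤ ε * I := by
    rw [abs_mul, abs_of_nonneg hI]
    exact mul_le_mul_of_nonneg_right hr hI
  rw [h1]
  refine (abs_add_three _ _ _).trans ?_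
  linarith

/-- The set of outcomes for which the spectrum is well behaved but the quadratic form `Q` is not
`ε`-close to `offMean ev * r` for any `r` between the two thresholds. -/
def atypicalOutcomes {Ω : Type*} {N : ℕ} (ev : Ω → Fin N → ℝ) (Q : Ω → ℝ) (B : ℕ)
    (T T' ε C L : ℝ) : Set Ω :=
  {ω | (∀ i : Fin N, (i : ℕ) ≠ 0 → ev ω i ≤ L) ∧ offMean (ev ω) ≤ C ∧
    ¬ ∃ r : ℝ, massThreshold T' B N ≤ r ∧ r ≤ massThreshold T B N ∧
      |Q ω - offMean (ev ω) * r| ≤ ε}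

theorem abs_sub_le_of_notMem_atypicalOutcomes {Ω : Type*} {N B : ℕ} {ev : Ω → Fin N → ℝ} {Q : Ω → ℝ}
    {T T' ε L s I : ℝ} {ω : Ω} (hT' : 0 < T') (hI : 0 ≤ I)
    (hω : ω ∉ atypicalOutcomes ev Q B T T' ε (I + ε) L)
    (hL : ∀ i : Fin N, (i : ℕ) ≠ 0 → ev ω i ≤ L) (hlam : |offMean (ev ω) - I| ≤ ε)
    (hs : |massThreshold T B N - s| ≤ ε) (hs' : |massThreshold T' B N - s| ≤ ε) :
    |Q ω - s * I| ≤ ε * (2 + I) := by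
  simp only [atypicalOutcomes, Set.mem_ofPred_eq, not_and, not_not] at hω
  obtain ⟨r, h1, h2, h3⟩ := hω hL (by linarith [(abs_le.1 hlam).2])
  refine abs_sub_mul_le_of_near (abs_le.2 ⟨?_, ?_⟩) ((massThreshold_pos hT').le.trans h1)
    (h2.trans massThreshold_le_one) hI hlam h3
  · linarith [(abs_le.1 hs').1]
  · linarith [(abs_le.1 hs).2]

/-- Atypical outcomes have the small probability that random codebooks guarantee. -/
def AtypicalOutcomesBound {Ω : Type*} [MeasurableSpace Ω] (P : Measure Ω) {N : ℕ}
    (ev : Ω → Fin N → ℝ) (Q : Ω → ℝ) (B : ℕ) : Prop :=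
  ∀ T T' ε C L : ℝ, 0 < T → 0 < T' → 0 < ε → 0 ≤ L →
    P (atypicalOutcomes ev Q B T T' ε C L) ≤ ENNReal.ofReal (Real.exp (-T)
      + T * (2 * Real.exp (-(ε ^ 2 * (N - 1 : ℕ) / (4 * (C + ε) * (L + C + ε))))) + T')

/-! ### Convergence in probability and almost surely. -/

section Limit

variable {Ω : Type*} [MeasurableSpace Ω] {P : Measure Ω} {N B : ℕ → ℕ} {b : ℝ}
  {ev : (n : ℕ) → Ω → Fin (N n) → ℝ} {Q : ℕ → Ω → ℝ} {I : ℝ}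

theorem tendstoInMeasure_of_atypicalOutcomesBound (hN : Tendsto N atTop atTop)
    (hB : Tendsto (fun n => (B n : ℝ) / N n) atTop (𝓝 b)) (hI : 0 ≤ I)
    (hbound : ∀ᶠ n in atTop, AtypicalOutcomesBound P (ev n) (Q n) (B n))
    (hmean : ∀ ε > (0 : ℝ), ∀ δ > (0 : ℝ), ∀ᶠ n in atTop,
      P {ω | ε < |offMean (ev n ω) - I|} ≤ ENNReal.ofReal δ)
    (hmax : ∀ ε > (0 : ℝ), ∀ δ > (0 : ℝ), ∀ᶠ n in atTop,
      P {ω | ¬ ∀ i : Fin (N n), (i : ℕ) ≠ 0 → ev n ω i ≤ ε * N n} ≤ ENNReal.ofReal δ) :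
    TendstoInMeasure P Q atTop fun _ => (2 : ℝ) ^ (-b) * I := by
  rw [tendstoInMeasure_iff_norm]
  intro η hη
  rw [ENNReal.tendsto_nhds_zero]
  intro δ' hδ'
  obtain ⟨δ, hδ, hδδ'⟩ : ∃ δ : ℝ, 0 < δ ∧ ENNReal.ofReal δ ≤ δ' := by
    obtain ⟨d, hd0, hd⟩ := ENNReal.lt_iff_exists_nnreal_btwn.1 hδ'
    exact ⟨d, by exact_mod_cast hd0, by rw [ENNReal.ofReal_coe_nnreal]; exact hd.le⟩
  have hNr : Tendsto (fun n => (N n : ℝ)) atTop atTop := tendsto_natCast_atTop_atTop.comp hN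
  have hδ5 : 0 < δ / 5 := by positivity
  let ε := η / (2 * (2 + I))
  have hε : 0 < ε := by positivity
  have hεη : ε * (2 + I) < η := by
    have : ε * (2 + I) = η / 2 := by simp only [ε]; field_simp
    linarith
  have hexp0 : Tendsto (fun x : ℝ => Real.exp (-x)) atTop (𝓝 0) :=
    Real.tendsto_exp_neg_atTop_nhds_zero
  obtain ⟨T, hT1, hT⟩ := ((hexp0.eventually_le_const hδ5).and (eventually_gt_atTop 0)).exists
  have hexpT : Tendsto (fun x : ℝ => T * (2 * Real.exp (-x))) atTop (𝓝 0) := by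
    simpa using (hexp0.const_mul 2).const_mul T
  obtain ⟨G, hG1, hG⟩ := ((hexpT.eventually_le_const hδ5).and (eventually_gt_atTop 0)).exists
  have hCε : 0 < I + ε + ε := by positivity
  -- `T`, `G` and `κ` are chosen in this order. With `L = κ N`, `L + I + 2ε ≤ 2κN` and `N - 1 ≥ N /
  -- 2`, the Chernoff exponent is at least `G`. The budget `δ` is split among three codebook errors
  -- and two spectral ones.
  let κ := ε ^ 2 / (16 * (I + ε + ε) * G)
  have hκ : 0 < κ := by positivity
  have hlog : ∀ T : ℝ, Tendsto (fun n => Real.log T / N n) atTop (𝓝 0) := fun T =>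
    tendsto_const_nhds.div_atTop hNr
  have hthr := tendsto_massThreshold hN hB (Filter.Eventually.of_forall fun _ => hT) (hlog T)
  have hthr' := tendsto_massThreshold hN hB (Filter.Eventually.of_forall fun _ => hδ5)
    (hlog (δ / 5))
  filter_upwards [hbound, hmean ε hε _ hδ5, hmax κ hκ _ hδ5, hN.eventually_ge_atTop 2,
    hNr.eventually_ge_atTop ((I + ε + ε) / κ),
    hthr.eventually (Metric.closedBall_mem_nhds _ hε),
    hthr'.eventually (Metric.closedBall_mem_nhds _ hε)] with n h1 h2 h3 h4 h5 h6 h7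
  have h4r : (2 : ℝ) ≤ N n := by exact_mod_cast h4
  have hG' : G ≤ ε ^ 2 * (N n - 1 : ℕ) / (4 * (I + ε + ε) * (κ * N n + (I + ε) + ε)) := by
    rw [div_le_iff₀ hκ] at h5
    have hle : 4 * (I + ε + ε) * (κ * N n + (I + ε) + ε) ≤ 4 * (I + ε + ε) * (2 * κ * N n) := by
      refine mul_le_mul_of_nonneg_left ?_ (by positivity)
      linarith
    have hN2 : (N n : ℝ) / 2 ≤ (N n - 1 : ℕ) := by
      rw [Nat.cast_sub (by omega), Nat.cast_one]; linarith
    calc G = ε ^ 2 * (N n / 2) / (4 * (I + ε + ε) * (2 * κ * N n)) := by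
          simp only [κ]
          field_simp
          norm_num
      _ ≤ _ := by gcongr
  have h8 := h1 T (δ / 5) ε (I + ε) (κ * N n) hT hδ5 hε (by positivity)
  have h9 : Real.exp (-T) + T * (2 * Real.exp (-(ε ^ 2 * (N n - 1 : ℕ) /
      (4 * (I + ε + ε) * (κ * N n + (I + ε) + ε))))) + δ / 5 ≤ δ / 5 + δ / 5 + δ / 5 := by
    gcongr
    refine le_trans ?_ hG1
    gcongr
  refine le_trans ?_ hδδ'
  refine (measure_mono (t := (atypicalOutcomes (ev n) (Q n) (B n) T (δ / 5) ε (I + ε) (κ * N n) ∪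
    {ω | ε < |offMean (ev n ω) - I|}) ∪
    {ω | ¬ ∀ i : Fin (N n), (i : ℕ) ≠ 0 → ev n ω i ≤ κ * N n}) fun ω hω => ?_).trans ?_
  · by_contra hcon
    simp only [Set.mem_union, not_or] at hcon
    obtain ⟨⟨hc1, hc2⟩, hc3⟩ := hcon
    simp only [Set.mem_ofPred_eq, not_not, not_lt] at hc2 hc3
    have := abs_sub_le_of_notMem_atypicalOutcomes hδ5 hI hc1 hc3 hc2
      (by simpa [Real.dist_eq] using h6) (by simpa [Real.dist_eq] using h7)
    have hω' : η ≤ |Q n ω - 2 ^ (-b) * I| := hω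
    linarith
  · refine (measure_union_le _ _).trans ((add_le_add ((measure_union_le _ _).trans
      (add_le_add (h8.trans (ENNReal.ofReal_le_ofReal h9)) h2)) h3).trans (le_of_eq ?_))
    rw [← ENNReal.ofReal_add (by positivity) (by positivity),
      ← ENNReal.ofReal_add (by positivity) (by positivity)]
    congr 1
    ring

theorem ae_tendsto_of_atypicalOutcomesBound [IsProbabilityMeasure P] (hmono : StrictMono N)
    (hB : Tendsto (fun n => (B n : ℝ) / N n) atTop (𝓝 b)) (hI : 0 ≤ I)
    (hbound : ∀ᶠ n in atTop, AtypicalOutcomesBound P (ev n) (Q n) (B n))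
    (hmean : ∀ᵐ ω ∂P, ∀ ε > (0 : ℝ), ∀ᶠ n in atTop, |offMean (ev n ω) - I| ≤ ε)
    (hgrowth : SpectrumGrowthAS P ev) :
    ∀ᵐ ω ∂P, Tendsto (fun n => Q n ω) atTop (𝓝 ((2 : ℝ) ^ (-b) * I)) := by
  have hN : Tendsto N atTop atTop := hmono.tendsto_atTop
  have hNr : Tendsto (fun n => (N n : ℝ)) atTop atTop := tendsto_natCast_atTop_atTop.comp hN
  have hlogN : Tendsto (fun n => Real.log (N n)) atTop atTop := Real.tendsto_log_atTop.comp hNr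
  have hlogdiv : Tendsto (fun n => Real.log (N n) / N n) atTop (𝓝 0) := by
    have := (Real.isLittleO_log_id_atTop.tendsto_div_nhds_zero).comp hNr
    exact this
  -- This gives `exp (-T) = N⁻²`, matching `T' = N⁻²`, while both logarithms remain `o(N)` and so
  -- leave the thresholds' limit unchanged.
  let T : ℕ → ℝ := fun n => 2 * Real.log (N n)
  let T' : ℕ → ℝ := fun n => ((N n : ℝ) ^ 2)⁻¹
  have hTpos : ∀ᶠ n in atTop, 0 < T n := by
    filter_upwards [hlogN.eventually_gt_atTop 0] with n hn
    simp only [T]; positivity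
  have hTpos' : ∀ᶠ n in atTop, 0 < T' n := by
    filter_upwards [hNr.eventually_gt_atTop 0] with n hn
    simp only [T']; positivity
  have hthr := tendsto_massThreshold hN hB hTpos (T := T) (by
    have h1 : Tendsto (fun n => Real.log (T n) / T n * (2 * (Real.log (N n) / N n))) atTop
        (𝓝 (0 * (2 * 0))) :=
      ((Real.isLittleO_log_id_atTop.tendsto_div_nhds_zero).comp
        (hlogN.const_mul_atTop (show (0 : ℝ) < 2 by norm_num))).mul (hlogdiv.const_mul 2)
    rw [zero_mul] at h1
    refine h1.congr' ?_
    filter_upwards [hTpos] with n hn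
    have : T n / N n = 2 * (Real.log (N n) / N n) := by simp only [T]; ring
    rw [← this]
    field_simp)
  have hthr' := tendsto_massThreshold hN hB hTpos' (T := T') (by
    have h1 := hlogdiv.const_mul (-2)
    rw [mul_zero] at h1
    refine h1.congr fun n => ?_
    simp only [T']
    rw [Real.log_inv, Real.log_pow]
    push_cast
    ring)
  have key : ∀ ε > (0 : ℝ), ∀ᵐ ω ∂P, ∀ᶠ n in atTop, |Q n ω - 2 ^ (-b) * I| ≤ ε * (2 + I) := by
    intro ε hε
    have hCε : 0 < I + ε + ε := by positivity
    -- The constant makes the Chernoff exponent at least `3 log N` when `L = γ N / log N`. With the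
    -- crude bound `T ≤ 2 N` the deviation term is at most `4 N⁻²`, so the total is `6 N⁻²`.
    let γ := ε ^ 2 / (48 * (I + ε + ε))
    have hγ : 0 < γ := by positivity
    let L : ℕ → ℝ := fun n => γ * N n / Real.log (N n)
    have hP : ∀ᶠ n in atTop, P (atypicalOutcomes (ev n) (Q n) (B n) (T n) (T' n) ε (I + ε) (L n))
        ≤ ENNReal.ofReal (6 * ((n : ℝ) ^ 2)⁻¹) := by
      filter_upwards [hbound, hTpos, hTpos', hlogN.eventually_gt_atTop 0,
        hN.eventually_ge_atTop 2,
        hlogdiv.eventually_le_const (show 0 < γ / (I + ε + ε) by positivity),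
        hlogdiv.eventually_le_const one_pos, eventually_gt_atTop 0]
        with n h1 h2 h3 h4 h5 h6 h7 h8
      have hL0 : 0 ≤ L n := by simp only [L]; positivity
      refine (h1 (T n) (T' n) ε (I + ε) (L n) h2 h3 hε hL0).trans (ENNReal.ofReal_le_ofReal ?_)
      have h5r : (2 : ℝ) ≤ N n := by exact_mod_cast h5
      have hN0 : (0 : ℝ) < N n := by linarith
      have hexplog : ∀ k : ℕ, Real.exp (-(k * Real.log (N n))) = ((N n : ℝ) ^ k)⁻¹ := by
        intro k
        rw [Real.exp_neg, Real.exp_nat_mul, Real.exp_log hN0]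
      have hLe : I + ε + ε ≤ L n := by
        rw [div_le_div_iff₀ hN0 hCε] at h6
        simp only [L]
        rw [le_div_iff₀ h4]
        linarith
      have hN2 : (N n : ℝ) / 2 ≤ (N n - 1 : ℕ) := by
        rw [Nat.cast_sub (by omega), Nat.cast_one]; linarith
      have hexponent : 3 * Real.log (N n) ≤
          ε ^ 2 * (N n - 1 : ℕ) / (4 * (I + ε + ε) * (L n + (I + ε) + ε)) := by
        have hle : 4 * (I + ε + ε) * (L n + (I + ε) + ε) ≤ 4 * (I + ε + ε) * (2 * L n) := by
          refine mul_le_mul_of_nonneg_left ?_ (by positivity)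
          linarith
        calc 3 * Real.log (N n) = ε ^ 2 * (N n / 2) / (4 * (I + ε + ε) * (2 * L n)) := by
              simp only [L, γ]
              field_simp
              norm_num
          _ ≤ _ := by gcongr
      have h9 : Real.exp (-(ε ^ 2 * (N n - 1 : ℕ) / (4 * (I + ε + ε) * (L n + (I + ε) + ε))))
          ≤ ((N n : ℝ) ^ 3)⁻¹ := by
        rw [← hexplog 3]
        exact Real.exp_le_exp.2 (neg_le_neg (by exact_mod_cast hexponent))
      have h10 : Real.exp (-T n) = ((N n : ℝ) ^ 2)⁻¹ := by
        rw [← hexplog 2]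
        simp [T]
      have h11 : T n ≤ 2 * N n := by
        rw [div_le_one hN0] at h7
        simp only [T]; linarith
      have h12 : T n * (2 * Real.exp (-(ε ^ 2 * (N n - 1 : ℕ) /
          (4 * (I + ε + ε) * (L n + (I + ε) + ε))))) ≤ 4 * ((N n : ℝ) ^ 2)⁻¹ := by
        calc _ ≤ (2 * N n) * (2 * ((N n : ℝ) ^ 3)⁻¹) := by gcongr
          _ = 4 * ((N n : ℝ) ^ 2)⁻¹ := by field_simp; norm_num
      -- Strict monotonicity gives `n ≤ N n`, which makes the errors summable in `n`.
      have h13 : ((N n : ℝ) ^ 2)⁻¹ ≤ ((n : ℝ) ^ 2)⁻¹ := by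
        have : (n : ℝ) ≤ N n := by exact_mod_cast hmono.id_le n
        gcongr
      rw [h10]
      simp only [T'] at *
      linarith
    obtain ⟨n0, hn0⟩ := eventually_atTop.1 hP
    have hBC : ∀ᵐ ω ∂P, ∀ᶠ n in atTop, ω ∉ {ω | n0 ≤ n ∧
        ω ∈ atypicalOutcomes (ev n) (Q n) (B n) (T n) (T' n) ε (I + ε) (L n)} := by
      refine ae_eventually_notMem (ne_top_of_le_ne_top
        (b := ∑' n : ℕ, ENNReal.ofReal (6 * ((n : ℝ) ^ 2)⁻¹)) ?_ (ENNReal.tsum_le_tsum fun n => ?_))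
      · have hsum : Summable fun n : ℕ => 6 * ((n : ℝ) ^ 2)⁻¹ :=
          (Real.summable_nat_pow_inv.2 (by norm_num)).mul_left 6
        exact hsum.tsum_ofReal_ne_top
      · by_cases hn : n0 ≤ n
        · exact (measure_mono fun ω hω => hω.2).trans (hn0 n hn)
        · simp [hn]
    filter_upwards [hBC, hmean, hgrowth] with ω h1 h2 h3
    filter_upwards [h1, h2 ε hε, h3 γ hγ, eventually_ge_atTop n0, hTpos',
      hlogN.eventually_gt_atTop 0, hthr.eventually (Metric.closedBall_mem_nhds _ hε),
      hthr'.eventually (Metric.closedBall_mem_nhds _ hε)] with n h4 h5 h6 h7 h8 h9 h10 h11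
    refine abs_sub_le_of_notMem_atypicalOutcomes h8 hI (fun hmem => h4 ⟨h7, hmem⟩)
      (fun i hi => ?_) h5 (by simpa [Real.dist_eq] using h10) (by simpa [Real.dist_eq] using h11)
    rw [le_div_iff₀ h9]
    exact h6 i hi
  -- The exceptional null set depends on `ε`; a countable sequence of tolerances gives a common one.
  have hall : ∀ᵐ ω ∂P, ∀ k : ℕ, ∀ᶠ n in atTop,
      |Q n ω - 2 ^ (-b) * I| ≤ 1 / ((k : ℝ) + 1) * (2 + I) :=
    ae_all_iff.2 fun k => key _ (by positivity)
  filter_upwards [hall] with ω hω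
  rw [Metric.tendsto_nhds]
  intro η hη
  obtain ⟨k, hk⟩ := exists_nat_one_div_lt (show 0 < η / (2 + I) by positivity)
  filter_upwards [hω k] with n hn
  rw [Real.dist_eq]
  refine hn.trans_lt ?_
  rwa [lt_div_iff₀ (by positivity)] at hk

end Limit

/-! ### Assembly of both modes of convergence. -/

theorem lemma1 {Ω : Type*} [MeasurableSpace Ω] (P : Measure Ω) [IsProbabilityMeasure P]
    (N B K : ℕ → ℕ) (Bbar Kbar : ℝ)
    (hpos : ∀ n, 0 < N n)
    (hN : Tendsto N atTop atTop)
    (hB : Tendsto (fun n => (B n : ℝ) / N n) atTop (𝓝 Bbar))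
    (hK : Tendsto (fun n => (K n : ℝ) / N n) atTop (𝓝 Kbar))
    -- the random effective signature matrices and the spectral decompositions of `S Sᴴ`
    (S : (n : ℕ) → Ω → Matrix (Fin (N n)) (Fin (K n)) ℂ)
    (ev : (n : ℕ) → Ω → Fin (N n) → ℝ)
    (u : (n : ℕ) → Ω → Fin (N n) → CVec (N n))
    (hS : ∀ n i k, Measurable (fun ω => S n ω i k))
    (hu : ∀ n i, Measurable (fun ω => u n ω i))
    (hdec : ∀ n ω, IsSpectralDecomp (S n ω * (S n ω).conjTranspose) (ev n ω) (u n ω))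
    -- the codebooks, independent of the matrix and its eigenvectors
    (V : (n : ℕ) → Fin (2 ^ B n) → Ω → CVec (N n))
    (hV : ∀ n, IsRVQCodebook P (V n))
    (hind : ∀ n, IndepFun
      (fun ω => ((fun i k => S n ω i k : Fin (N n) → Fin (K n) → ℂ), u n ω))
      (fun ω j => V n j ω) P)
    -- the entry that is closest in angle to the principal eigenvector
    (J : (n : ℕ) → Ω → Fin (2 ^ B n))
    (hJ : ∀ n ω, IsClosestInAngle (u n ω ⟨0, hpos n⟩) (fun j => V n j ω) (J n ω))
    -- the limiting eigenvalue distribution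
    (ν : Measure ℝ) [IsProbabilityMeasure ν] :
    (SpectrumTendstoInProb P ev ν → SpectrumUIInProb P ev →
      IntegrableOn (fun x : ℝ => x) (Set.Ici 0) ν ∧
      TendstoInMeasure P (fun n ω => offPrincipal (ev n ω) (u n ω) (V n (J n ω) ω)) atTop
        (fun _ => (2 : ℝ) ^ (-Bbar) * ∫ x in Set.Ici 0, x ∂ν)) ∧
    (StrictMono N → SpectrumTendstoAS P ev ν → SpectrumUIAS P ev → SpectrumGrowthAS P ev →
      IntegrableOn (fun x : ℝ => x) (Set.Ici 0) ν ∧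
      ∀ᵐ ω ∂P, Tendsto (fun n => offPrincipal (ev n ω) (u n ω) (V n (J n ω) ω)) atTop
        (𝓝 ((2 : ℝ) ^ (-Bbar) * ∫ x in Set.Ici 0, x ∂ν))) := by

  have hev : ∀ n ω i, 0 ≤ ev n ω i := fun n ω i => (hdec n ω).nonneg i
  have hI : 0 ≤ ∫ x in Set.Ici (0 : ℝ), x ∂ν := setIntegral_nonneg measurableSet_Ici fun x hx => hx
  have hbound : ∀ᶠ n in atTop, AtypicalOutcomesBound P (ev n)
      (fun ω => offPrincipal (ev n ω) (u n ω) (V n (J n ω) ω)) (B n) := by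
    -- At `N = 1` the exponent `(N - 1)⁻¹` takes its default value 0 and the threshold no longer
    -- controls the expected count, so only `N ≥ 2` is used.
    filter_upwards [hN.eventually_ge_atTop 2] with n hn T T' ε C L hT hT' hε hL
    exact measure_closest_atypical_le (hpos n) (by positivity) (hS n) (hu n) (hdec n) (hV n)
      (hind n) (hJ n) (massThreshold_pos hT) massThreshold_le_one (massThreshold_eq_one_or hT hn)
      (two_pow_mul_massThreshold_pow_le hT hn) (massThreshold_pos hT') massThreshold_le_one
      (two_pow_mul_massThreshold_pow_le hT' hn) hε hL
  refine ⟨fun hconv hui => ⟨(hconv.integrableOn_and_tendsto hN hev hui).1, ?_⟩,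
    fun hmono hconv hui hgrowth => ⟨(hconv.integrableOn_and_tendsto hN hev hui).1, ?_⟩⟩
  · exact tendstoInMeasure_of_atypicalOutcomesBound hN hB hI hbound
      (fun ε hε δ hδ => hconv.offMean_near hN hev hui hε hδ)
      (fun ε hε δ hδ => hui.le_mul hN hev hε hδ)
  · exact ae_tendsto_of_atypicalOutcomesBound hmono hB hI hbound
      (hconv.offMean_near hN hev hui) hgrowth
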